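/- Let $\Delta\in\mathbb N$, let $\lambda^\star>0$, and let $\mathcal G$ be a family of finite graphs of maximum degree at most $\Delta$. If the hard-core model on $\mathcal G$ satisfies very strong spatial mixing (VSSM) at $\lambda^\star$, then the hard-core model at fugacity $\lambda^\star$ is spectrally independent on $\mathcal G$. Here the terms are defined as follows. *Conditional ratios.* For $\lambda>0$, the hard-core model on a finite graph $G=(V,E)$ is the probability measure on the independent sets $I$ of $G$ with $\mu_{G,\lambda}(I)\propto\lambda^{|I|}$. A boundary condition on $G$ is a map $\sigma:V_\sigma\to\{0,1\}$ with $V_\sigma\subseteq V$ such that $\sigma^{-1}(1)$ is independent. For $v\in V\setminus V_\sigma$ put $$R_{(G,\sigma),v}(\lambda)=\frac{\sum_{I\ni v}\lambda^{|I|}}{\sum_{I\not\ni v}\lambda^{|I|}},$$ where both sums run over those $I\subseteq V\setminus V_\sigma$ for which $I\cup\sigma^{-1}(1)$ is independent in $G$. *Tree of self-avoiding walks.* Given a finite graph $H$ with a total order on its vertices and a vertex $v$ of $H$ with neighbours $v_1<\dots<v_d$, the tree $T_{\mathrm{SAW}(H,v)}$ is obtained recursively from the disjoint union of the trees $T_{\mathrm{SAW}(H_i,v_i)}$,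 $i=1,\dots,d$, where $H_i$ is $H$ with the vertices $v,v_1,\dots,v_{i-1}$ removed (and the inherited order), by adding a root, again called $v$, and joining it to the root $v_i$ of each of these trees. (If $d=0$, the tree is the single vertex $v$.) *VSSM.* For every graph in $\mathcal G$ some total order of its vertices is fixed, and its induced subgraphs carry the inherited order. The hard-core model on $\mathcal G$ satisfies VSSM at $\lambda>0$ if there are constants $\alpha\in[0,1)$ and $C>0$ such that for all $G\in\mathcal G$, all induced subgraphs $H$ of $G$, all $v\in V(H)$, all integers $\ell\ge 1$ and all boundary conditions $\sigma,\tau$ defined exactly on the set of vertices at distance $\ell$ from $v$ in $T=T_{\mathrm{SAW}(H,v)}$, $$\bigl|R_{(T,\sigma),v}(\lambda)-R_{(T,\tau),v}(\lambda)\bigr|\le C\,\alpha^{\ell}.$$ *Spectral independence.* For a finite graph $H$ and distinct vertices $u,v$ let $\Psi_{H,\lambda}(u\to v)=\mathbb P[v\in\mathbf I\mid u\in\mathbf I]-\mathbb P[v\in\mathbf I\mid u\notin\mathbf I]$ with $\mathbf I\sim\mu_{H,\lambda}$, and let $I_{H,\lambda}$ be the $V(H)\times V(H)$ matrix with entries $\Psi_{H,\lambda}(u\to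 v)$ for $u\ne v$ and zero diagonal. The hard-core model at fugacity $\lambda$ is spectrally independent on $\mathcal G$ if there is a constant $\eta>0$ such that for all $G\in\mathcal G$ and all induced subgraphs $H$ of $G$, all eigenvalues of $I_{H,\lambda}$ are real and at most $\eta$. -/

import Mathlib

universe u

/-! ### Hard-core model, boundary conditions and occupation ratios -/

/-- A boundary condition on `G`: a map `val : dom → {0, 1}` on a set `dom` of vertices such that the
set of vertices that receive the value `1` is independent in `G`. -/
structure BoundaryCondition {V : Type u} (G : SimpleGraph V) where
  dom : Set V
  val : dom → Fin 2
  indep : G.IsIndepSet {x : V | ∃ h : x ∈ dom, val ⟨x, h⟩ = 1}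

/-- The set of vertices to which the boundary condition gives the value `1`. -/
def BoundaryCondition.inSet {V : Type u} {G : SimpleGraph V} (σ : BoundaryCondition G) : Set V :=
  {x : V | ∃ h : x ∈ σ.dom, σ.val ⟨x, h⟩ = 1}

open Classical in
/-- The sum of `lam ^ |I|` over all sets `I` of vertices outside the domain of `σ` such that
`I ∪ σ⁻¹(1)` is independent, and that satisfy in addition the condition `P`. -/
noncomputable def condPartition {V : Type u} [Fintype V] (G : SimpleGraph V)
    (σ : BoundaryCondition G) (lam : ℝ) (P : Finset V → Prop) : ℝ :=
  ∑ I ∈ (Finset.univ : Finset (Finset V)).filter (fun I : Finset V =>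
    Disjoint (I : Set V) σ.dom ∧ G.IsIndepSet ((I : Set V) ∪ σ.inSet) ∧ P I), lam ^ I.card

/-- The conditional occupation ratio `R_{(G,σ),v}(lam) = Z^{v in} / Z^{v out}`. -/
noncomputable def condRatio {V : Type u} [Fintype V] (G : SimpleGraph V)
    (σ : BoundaryCondition G) (v : V) (lam : ℝ) : ℝ :=
  condPartition G σ lam (fun I => v ∈ I) / condPartition G σ lam (fun I => v ∉ I)

/-! ### The tree of self-avoiding walks -/

/-- The vertices of the tree of self-avoiding walks `T_SAW(G[A], v)` of the induced subgraph `G[A]`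
at a vertex `v ∈ A`, with respect to the given total order of the vertices. It has a root, which
stands for `v`, and contains, disjointly, for every neighbour `w` of `v` in `G[A]`, a copy of the
tree `T_SAW(G[A'], w)`, where `G[A']` is obtained from `G[A]` by removing `v` and all neighbours
of `v` that come before `w`. -/
inductive SAWVertex {V : Type u} [LinearOrder V] (G : SimpleGraph V) : Set V → V → Type u
  | root {A : Set V} {v : V} : SAWVertex G A v
  | child {A : Set V} {v : V} (w : V) (hA : w ∈ A) (hw : G.Adj v w)
      (p : SAWVertex G (A \ {x | x = v ∨ (G.Adj v x ∧ x < w)}) w) : SAWVertex G A v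

/-- `p` is the parent of `q`: the root is the parent of the roots of the subtrees
`T_SAW(G[A'], w)`, and inside each of these subtrees the relation is the one of that subtree. -/
inductive SAWVertex.Parent {V : Type u} [LinearOrder V] {G : SimpleGraph V} :
    ∀ {A : Set V} {v : V}, SAWVertex G A v → SAWVertex G A v → Prop
  | root {A : Set V} {v : V} (w : V) (hA : w ∈ A) (hw : G.Adj v w) :
      Parent (SAWVertex.root : SAWVertex G A v) (SAWVertex.child w hA hw SAWVertex.root)
  | child {A : Set V} {v : V} (w : V) (hA : w ∈ A) (hw : G.Adj v w)
      (p q : SAWVertex G (A \ {x | x = v ∨ (G.Adj v x ∧ x < w)}) w) (h : Parent p q) :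
      Parent (SAWVertex.child w hA hw p : SAWVertex G A v) (SAWVertex.child w hA hw q)

/-- The tree of self-avoiding walks `T_SAW(G[A], v)`, as a graph. -/
def sawTree {V : Type u} [LinearOrder V] (G : SimpleGraph V) (A : Set V) (v : V) :
    SimpleGraph (SAWVertex G A v) :=
  SimpleGraph.fromRel SAWVertex.Parent

/-- The vertex set of the tree is the root together with the disjoint union of the vertex sets of
the subtrees. -/
def SAWVertex.equivOption {V : Type u} [LinearOrder V] (G : SimpleGraph V) (A : Set V) (v : V) :
    SAWVertex G A v ≃ Option (Σ w : {w : V // w ∈ A ∧ G.Adj v w},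
      SAWVertex G (A \ {x | x = v ∨ (G.Adj v x ∧ x < w.1)}) w.1) where
  toFun
    | .root => none
    | .child w hA hw p => some ⟨⟨w, hA, hw⟩, p⟩
  invFun
    | none => .root
    | some ⟨⟨w, hA, hw⟩, p⟩ => .child w hA hw p
  left_inv := by rintro (_ | _) <;> rfl
  right_inv := by rintro (_ | ⟨⟨_, _, _⟩, _⟩) <;> rfl

theorem SAWVertex.finite_of_mem {V : Type u} [LinearOrder V] [Finite V] (G : SimpleGraph V)
    (A : Set V) : ∀ v ∈ A, Finite (SAWVertex G A v) := by
  induction A using WellFoundedLT.induction with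
  | ind A ih =>
    intro v hv
    have : ∀ w : {w : V // w ∈ A ∧ G.Adj v w},
        Finite (SAWVertex G (A \ {x | x = v ∨ (G.Adj v x ∧ x < w.1)}) w.1) := by
      rintro ⟨w, hw, hvw⟩
      refine ih _ ⟨Set.sdiff_subset, fun h => (h hv).2 (Or.inl rfl)⟩ w ⟨hw, ?_⟩
      rintro (h | h)
      · exact hvw.ne h.symm
      · exact lt_irrefl _ h.2
    exact Finite.of_equiv _ (SAWVertex.equivOption G A v).symm

instance SAWVertex.instFinite {V : Type u} [LinearOrder V] [Finite V] (G : SimpleGraph V)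
    (A : Set V) (v : V) : Finite (SAWVertex G A v) := by
  have : ∀ w : {w : V // w ∈ A ∧ G.Adj v w},
      Finite (SAWVertex G (A \ {x | x = v ∨ (G.Adj v x ∧ x < w.1)}) w.1) := by
    rintro ⟨w, hw, hvw⟩
    refine SAWVertex.finite_of_mem G _ w ⟨hw, ?_⟩
    rintro (h | h)
    · exact hvw.ne h.symm
    · exact lt_irrefl _ h.2
  exact Finite.of_equiv _ (SAWVertex.equivOption G A v).symm

noncomputable instance SAWVertex.instFintype {V : Type u} [LinearOrder V] [Finite V]
    (G : SimpleGraph V) (A : Set V) (v : V) : Fintype (SAWVertex G A v) :=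
  Fintype.ofFinite _

/-! ### Very strong spatial mixing -/

/-- Very strong spatial mixing at `lam` of the hard-core model on the family `(G i)` of finite
graphs. For each graph of the family some total order of its vertices is fixed; the trees of
self-avoiding walks of all its induced subgraphs `(G i)[A]` are formed with respect to it. The
boundary conditions `σ`, `τ` are arbitrary maps to `{0, 1}` on the sphere of radius `ℓ` around the
root. -/
def VSSM {ι : Type*} {V : ι → Type*} [∀ i, Fintype (V i)] (G : ∀ i, SimpleGraph (V i))
    (lam : ℝ) : Prop :=
  ∃ α C : ℝ, 0 ≤ α ∧ α < 1 ∧ 0 < C ∧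
    ∀ i, ∃ _ : LinearOrder (V i), ∀ (A : Set (V i)), ∀ v ∈ A, ∀ ℓ : ℕ, 1 ≤ ℓ →
      ∀ σ τ : BoundaryCondition (sawTree (G i) A v),
        σ.dom = {x | (sawTree (G i) A v).dist SAWVertex.root x = ℓ} →
        τ.dom = {x | (sawTree (G i) A v).dist SAWVertex.root x = ℓ} →
        |condRatio (sawTree (G i) A v) σ SAWVertex.root lam
          - condRatio (sawTree (G i) A v) τ SAWVertex.root lam| ≤ C * α ^ ℓ

/-! ### Spectral independence -/

open Classical in
/-- The sum of `lam ^ |I|` over all independent sets `I` of `G` that satisfy `P`. -/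
noncomputable def hardCoreWeight {V : Type u} [Fintype V] (G : SimpleGraph V) (lam : ℝ)
    (P : Finset V → Prop) : ℝ :=
  ∑ I ∈ (Finset.univ : Finset (Finset V)).filter (fun I : Finset V =>
    G.IsIndepSet (I : Set V) ∧ P I), lam ^ I.card

/-- The probability of the event `P` under the hard-core measure of `G` at fugacity `lam`. -/
noncomputable def hardCoreProb {V : Type u} [Fintype V] (G : SimpleGraph V) (lam : ℝ)
    (P : Finset V → Prop) : ℝ :=
  hardCoreWeight G lam P / hardCoreWeight G lam (fun _ => True)

/-- The conditional probability of `P` given `Q` under the hard-core measure. -/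
noncomputable def hardCoreCondProb {V : Type u} [Fintype V] (G : SimpleGraph V) (lam : ℝ)
    (P Q : Finset V → Prop) : ℝ :=
  hardCoreProb G lam (fun I => P I ∧ Q I) / hardCoreProb G lam Q

/-- The influence `Ψ(a → b) = ℙ[b ∈ I | a ∈ I] - ℙ[b ∈ I | a ∉ I]`. -/
noncomputable def influence {V : Type u} [Fintype V] (G : SimpleGraph V) (lam : ℝ)
    (a b : V) : ℝ :=
  hardCoreCondProb G lam (fun I => b ∈ I) (fun I => a ∈ I)
    - hardCoreCondProb G lam (fun I => b ∈ I) (fun I => a ∉ I)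

open Classical in
/-- The influence matrix, with zero diagonal. -/
noncomputable def influenceMatrix {V : Type u} [Fintype V] (G : SimpleGraph V) (lam : ℝ) :
    Matrix V V ℝ :=
  Matrix.of fun a b => if a = b then 0 else influence G lam a b

open Classical in
/-- Spectral independence at `lam` of the hard-core model on the family `(G i)`: a uniform bound on
the largest eigenvalue of the influence matrices of all induced subgraphs. As these matrices need
not be symmetric, it is part of the definition that all complex eigenvalues are real, so that one
can speak of the largest one. -/
def SpectrallyIndependent {ι : Type*} {V : ι → Type*} [∀ i, Fintype (V i)]
    (G : ∀ i, SimpleGraph (V i)) (lam : ℝ) : Prop :=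
  ∃ η : ℝ, 0 < η ∧ ∀ i, ∀ A : Set (V i),
    ∀ z ∈ spectrum ℂ ((influenceMatrix ((G i).induce A) lam).map Complex.ofReal),
      z.im = 0 ∧ z.re ≤ η

/-! Deleting the neighbours of a vertex one at a time, in their order, expresses its effect on all
other vertices through the effects of its neighbours in smaller graphs. Iterating this bounds the
total absolute influence of a vertex by a sum over the paths of its self-avoiding walk tree that
start at the root, each weighted by the product of the occupation probabilities below the root
(`sum_abs_marginal_sub_le`). The task is to bound the sum over the paths of length `ℓ` summably in
`ℓ` and uniformly in the graph.

Shift the log-ratios on level `ℓ` all by `s`. Since the paths have equal length, they contribute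
with the same sign, and the derivative in `s` of the log-ratio at the root is `(-1) ^ ℓ` times the
level sum (`hasDerivAt_logRatio`). The recursion is antitone, so for every `s` the value at the root
lies between those for a fully occupied and a fully empty level; by VSSM it oscillates only by order
`α ^ ℓ`. Small oscillation bounds the derivative once `|f''| ≤ K f'` is known
(`deriv_le_of_abs_deriv_le`). Differentiating the recursion shows that `K` grows per level by at
most the bound `c₀ α ^ ℓ K` on the level sum, so `K` stays below the convergent product of the `1 +
c₀ α ^ j` and the level sums are summable (`levelInfluence_le`).

This bounds the row sums of the influence matrix. The influence is a covariance divided by a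
variance depending only on the source, so the matrix is self-adjoint for a weighted inner product:
its eigenvalues are real, and Gershgorin's theorem bounds them. -/

/-! ### Recursions on branching systems

A branching system is a type `X` of states together with a finite family `st x : C x → X` of
successors of every state `x`. -/

section Branching

variable {X : Type*} {C : X → Type*} [∀ x, Fintype (C x)]

/-- The hard-core recursion for the probability of being unoccupied, unfolded `ℓ` times, with
values `β` at the bottom. -/
noncomputable def branchRec (st : ∀ x, C x → X) (lam : ℝ) (β : X → ℝ) : ℕ → X → ℝ
  | 0, x => β x
  | ℓ + 1, x => 1 / (1 + lam * ∏ c, branchRec st lam β ℓ (st x c))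

/-- The hard-core recursion for the logarithm of the occupation ratio, unfolded `ℓ` times, with
values `r` at the bottom that are all shifted by `s`. -/
noncomputable def logRatio (st : ∀ x, C x → X) (lam : ℝ) (r : X → ℝ) : ℕ → ℝ → X → ℝ
  | 0, s, x => s + r x
  | ℓ + 1, s, x =>
    Real.log lam - ∑ c, Real.log (1 + Real.exp (logRatio st lam r ℓ s (st x c)))

/-- The sum over all paths of length `ℓ` of the products of the occupation probabilities. -/
noncomputable def levelInfluence (st : ∀ x, C x → X) (lam : ℝ) (r : X → ℝ) : ℕ → ℝ → X → ℝ
  | 0, _, _ => 1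
  | ℓ + 1, s, x =>
    ∑ c, Real.sigmoid (logRatio st lam r ℓ s (st x c)) * levelInfluence st lam r ℓ s (st x c)

/-- The derivative of `levelInfluence` with respect to the shift. -/
noncomputable def levelInfluenceDeriv (st : ∀ x, C x → X) (lam : ℝ) (r : X → ℝ) :
    ℕ → ℝ → X → ℝ
  | 0, _, _ => 0
  | ℓ + 1, s, x =>
    ∑ c, (Real.sigmoid (logRatio st lam r ℓ s (st x c)) *
        (1 - Real.sigmoid (logRatio st lam r ℓ s (st x c))) *
        ((-1) ^ ℓ * levelInfluence st lam r ℓ s (st x c)) * levelInfluence st lam r ℓ s (st x c) +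
      Real.sigmoid (logRatio st lam r ℓ s (st x c)) * levelInfluenceDeriv st lam r ℓ s (st x c))

variable (st : ∀ x, C x → X) {lam : ℝ}

/-! ### Monotonicity of the recursion -/

theorem branchRec_nonneg (hlam : 0 < lam) {β : X → ℝ} (hβ : ∀ x, 0 ≤ β x) (ℓ : ℕ) (x : X) :
    0 ≤ branchRec st lam β ℓ x := by
  induction ℓ generalizing x with
  | zero => exact hβ x
  | succ ℓ ih =>
    have := Finset.prod_nonneg (s := Finset.univ) fun c _ => ih (st x c)
    rw [branchRec]
    positivity

theorem branchRec_antitone_step (hlam : 0 < lam) {β γ : X → ℝ} (hβ : ∀ x, 0 ≤ β x) {ℓ k : ℕ}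
    (h : ∀ x, branchRec st lam β ℓ x ≤ branchRec st lam γ k x) (x : X) :
    branchRec st lam γ (k + 1) x ≤ branchRec st lam β (ℓ + 1) x := by
  have h0 := Finset.prod_nonneg (s := Finset.univ)
    fun c _ => branchRec_nonneg st hlam hβ ℓ (st x c)
  have h1 := Finset.prod_le_prod (s := Finset.univ)
    (fun c _ => branchRec_nonneg st hlam hβ ℓ (st x c)) (fun c _ => h (st x c))
  simp only [branchRec]
  gcongr

/-- Each step of the recursion reverses the order, so which extreme boundary gives the lower bound
alternates with the parity of `ℓ`; hence the disjunction. -/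
theorem branchRec_between (hlam : 0 < lam) {β : X → ℝ} (hβ : ∀ x, 0 ≤ β x) (hβ1 : ∀ x, β x ≤ 1)
    (ℓ : ℕ) :
    (∀ x, branchRec st lam (fun _ => 0) ℓ x ≤ branchRec st lam β ℓ x ∧
      branchRec st lam β ℓ x ≤ branchRec st lam (fun _ => 1) ℓ x) ∨
    (∀ x, branchRec st lam (fun _ => 1) ℓ x ≤ branchRec st lam β ℓ x ∧
      branchRec st lam β ℓ x ≤ branchRec st lam (fun _ => 0) ℓ x) := by
  induction ℓ with
  | zero => exact Or.inl fun x => ⟨hβ x, hβ1 x⟩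
  | succ ℓ ih =>
    rcases ih with h | h
    · refine Or.inr fun x => ⟨?_, ?_⟩
      · exact branchRec_antitone_step st hlam hβ (fun x => (h x).2) x
      · exact branchRec_antitone_step st hlam (fun _ => le_rfl) (fun x => (h x).1) x
    · refine Or.inl fun x => ⟨?_, ?_⟩
      · exact branchRec_antitone_step st hlam hβ (fun x => (h x).2) x
      · exact branchRec_antitone_step st hlam (fun _ => zero_le_one) (fun x => (h x).1) x

theorem branchRec_succ_le_one (hlam : 0 < lam) {β : X → ℝ} (hβ : ∀ x, 0 ≤ β x) (ℓ : ℕ) (x : X) :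
    branchRec st lam β (ℓ + 1) x ≤ 1 := by
  have h0 := Finset.prod_nonneg (s := Finset.univ)
    fun c _ => branchRec_nonneg st hlam hβ ℓ (st x c)
  rw [branchRec, div_le_one (by positivity)]
  nlinarith [mul_nonneg hlam.le h0]

theorem branchRec_le_one (hlam : 0 < lam) {β : X → ℝ} (hβ : ∀ x, 0 ≤ β x) (hβ1 : ∀ x, β x ≤ 1)
    (ℓ : ℕ) (x : X) : branchRec st lam β ℓ x ≤ 1 := by
  cases ℓ with
  | zero => exact hβ1 x
  | succ ℓ => exact branchRec_succ_le_one st hlam hβ ℓ x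

theorem le_branchRec_succ (hlam : 0 < lam) {β : X → ℝ} (hβ : ∀ x, 0 ≤ β x) (hβ1 : ∀ x, β x ≤ 1)
    (ℓ : ℕ) (x : X) : 1 / (1 + lam) ≤ branchRec st lam β (ℓ + 1) x := by
  have h0 := Finset.prod_nonneg (s := Finset.univ)
    fun c _ => branchRec_nonneg st hlam hβ ℓ (st x c)
  have h1 : ∏ c, branchRec st lam β ℓ (st x c) ≤ 1 := Finset.prod_le_one
    (fun c _ => branchRec_nonneg st hlam hβ ℓ (st x c))
    (fun c _ => branchRec_le_one st hlam hβ hβ1 ℓ (st x c))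
  rw [branchRec]
  refine one_div_le_one_div_of_le (by positivity) ?_
  nlinarith

variable {r : X → ℝ}

/-! ### Log-ratios and their derivatives in the shift -/

theorem exp_logRatio_succ (hlam : 0 < lam) (ℓ : ℕ) (s : ℝ) (x : X) :
    Real.exp (logRatio st lam r (ℓ + 1) s x) =
      lam * ∏ c, (1 / (1 + Real.exp (logRatio st lam r ℓ s (st x c)))) := by
  rw [logRatio, Real.exp_sub, Real.exp_log hlam, Real.exp_sum, div_eq_mul_inv,
    ← Finset.prod_inv_distrib]
  congr 1
  refine Finset.prod_congr rfl fun c _ => ?_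
  rw [Real.exp_log (by positivity), one_div]

/-- Dictionary between the two recursions: a shift of the log-ratios at the bottom is a choice of
boundary probabilities strictly between 0 and 1. -/
theorem one_div_one_add_exp_logRatio (hlam : 0 < lam) (ℓ : ℕ) (s : ℝ) (x : X) :
    1 / (1 + Real.exp (logRatio st lam r ℓ s x)) =
      branchRec st lam (fun y => 1 / (1 + Real.exp (s + r y))) ℓ x := by
  induction ℓ generalizing x with
  | zero => rfl
  | succ ℓ ih =>
    rw [exp_logRatio_succ st hlam, branchRec]
    simp only [ih]

theorem hasDerivAt_log_one_add_exp {f : ℝ → ℝ} {f' s : ℝ} (hf : HasDerivAt f f' s) :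
    HasDerivAt (fun t => Real.log (1 + Real.exp (f t))) (Real.sigmoid (f s) * f') s := by
  convert (hf.exp.const_add 1).log (by positivity) using 1
  rw [Real.sigmoid_def, Real.exp_neg]
  have := Real.exp_pos (f s)
  field_simp
  ring

/-- By the chain rule each edge contributes minus the occupation probability of its lower end. All
paths have length `ℓ`, so the signs agree and nothing cancels. -/
theorem hasDerivAt_logRatio (ℓ : ℕ) (s : ℝ) (x : X) :
    HasDerivAt (fun t => logRatio st lam r ℓ t x)
      ((-1) ^ ℓ * levelInfluence st lam r ℓ s x) s := by
  induction ℓ generalizing x with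
  | zero => simpa [logRatio, levelInfluence] using (hasDerivAt_id s).add_const (r x)
  | succ ℓ ih =>
    have := (HasDerivAt.fun_sum (u := Finset.univ)
      fun c _ => hasDerivAt_log_one_add_exp (ih (st x c))).const_sub (Real.log lam)
    refine this.congr_deriv ?_
    rw [levelInfluence, pow_succ, mul_neg_one, neg_mul, Finset.mul_sum]
    congr 1
    exact Finset.sum_congr rfl fun c _ => by ring

theorem hasDerivAt_levelInfluence (ℓ : ℕ) (s : ℝ) (x : X) :
    HasDerivAt (fun t => levelInfluence st lam r ℓ t x)
      (levelInfluenceDeriv st lam r ℓ s x) s := by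
  induction ℓ generalizing x with
  | zero => exact hasDerivAt_const s 1
  | succ ℓ ih =>
    exact HasDerivAt.fun_sum (u := Finset.univ) fun c _ =>
      ((Real.hasDerivAt_sigmoid _).comp s (hasDerivAt_logRatio st ℓ s (st x c))).mul (ih (st x c))

theorem levelInfluence_nonneg (ℓ : ℕ) (s : ℝ) (x : X) : 0 ≤ levelInfluence st lam r ℓ s x := by
  induction ℓ generalizing x with
  | zero => exact zero_le_one
  | succ ℓ ih => exact Finset.sum_nonneg fun c _ => mul_nonneg (Real.sigmoid_nonneg _) (ih _)

/-- In the product rule, differentiating the factor `p` gives `p (1 - p)` times a level sum of size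
at most `M`, and the other factor contributes `K` by assumption. The bound is relative to the level
sum itself, which is what makes it iterable. -/
theorem abs_levelInfluenceDeriv_succ_le {ℓ : ℕ} {K M s : ℝ}
    (hK : ∀ x, |levelInfluenceDeriv st lam r ℓ s x| ≤ K * levelInfluence st lam r ℓ s x)
    (hM : ∀ x, levelInfluence st lam r ℓ s x ≤ M) (x : X) :
    |levelInfluenceDeriv st lam r (ℓ + 1) s x| ≤
      (K + M) * levelInfluence st lam r (ℓ + 1) s x := by
  rw [levelInfluenceDeriv, levelInfluence, Finset.mul_sum]
  refine (Finset.abs_sum_le_sum_abs _ _).trans (Finset.sum_le_sum fun c _ => ?_)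
  set a := levelInfluence st lam r ℓ s (st x c) with ha
  set p := Real.sigmoid (logRatio st lam r ℓ s (st x c))
  have ha0 : 0 ≤ a := levelInfluence_nonneg st ℓ s _
  have hp0 : 0 ≤ p := Real.sigmoid_nonneg _
  have hp1 : p ≤ 1 := Real.sigmoid_le_one _
  have h1 : |p * (1 - p) * ((-1) ^ ℓ * a) * a| ≤ p * (M * a) := by
    rw [abs_mul, abs_mul, abs_mul, abs_mul, abs_pow, abs_neg, abs_one, one_pow, one_mul,
      abs_of_nonneg ha0, abs_of_nonneg hp0, abs_of_nonneg (sub_nonneg.2 hp1), mul_assoc, mul_assoc]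
    refine mul_le_mul_of_nonneg_left ?_ hp0
    have : a * a ≤ M * a := mul_le_mul_of_nonneg_right (hM _) ha0
    nlinarith [mul_nonneg ha0 ha0]
  have h2 : |p * levelInfluenceDeriv st lam r ℓ s (st x c)| ≤ p * (K * a) := by
    rw [abs_mul, abs_of_nonneg hp0]
    exact mul_le_mul_of_nonneg_left (hK _) hp0
  calc _ ≤ _ := abs_add_le _ _
    _ ≤ p * (M * a) + p * (K * a) := add_le_add h1 h2
    _ = _ := by ring

/-- A function whose derivative `f'` is nonnegative and satisfies `|f''| ≤ K f'` has small
derivative if it varies little. -/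
theorem deriv_le_of_abs_deriv_le {f f' f'' : ℝ → ℝ} {K ε s : ℝ} (hK : 1 ≤ K)
    (hf : ∀ t, HasDerivAt f (f' t) t) (hf' : ∀ t, HasDerivAt f' (f'' t) t)
    (h : ∀ t, |f'' t| ≤ K * f' t) (hε : ∀ t u, |f t - f u| ≤ ε) : f' s ≤ 2 * K * ε := by
  obtain ⟨t, ht, hft⟩ := exists_hasDerivAt_eq_slope f f' (by linarith : s < s + 1)
    (fun t _ => (hf t).continuousAt.continuousWithinAt) (fun t _ => hf t)
  -- With `t` from the mean value theorem, `f' t = f (s + 1) - f s ≤ ε`. Monotonicity carries this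
  -- back to `s`: `f' s ≤ f' t + K (f t - f s) ≤ (1 + K) ε`, and `1 ≤ K`.
  have hmono : Monotone fun t => f' t + K * f t := by
    refine monotone_of_hasDerivAt_nonneg (f' := fun t => f'' t + K * f' t)
      (fun t => (hf' t).add ((hf t).const_mul K)) fun t => ?_
    have := neg_le_of_abs_le (h t)
    simp only [Pi.zero_apply]
    linarith
  have h1 := hmono ht.1.le
  have h2 := (le_abs_self _).trans (hε t s)
  have h3 := (le_abs_self _).trans (hε (s + 1) s)
  simp only [add_sub_cancel_left, div_one] at hft
  simp only at h1
  have h4 := mul_le_mul_of_nonneg_left h2 (zero_le_one.trans hK)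
  have h5 : 0 ≤ ε := (abs_nonneg _).trans (hε s s)
  nlinarith [mul_nonneg (sub_nonneg.2 hK) h5]

theorem abs_log_sub_log_le {x y m ε : ℝ} (hm : 0 < m) (hx : m ≤ x) (hy : m ≤ y)
    (h : |x - y| ≤ ε) : |Real.log x - Real.log y| ≤ ε / m := by
  wlog hxy : y ≤ x generalizing x y
  · rw [abs_sub_comm]
    exact this hy hx (by rwa [abs_sub_comm]) (le_of_not_ge hxy)
  have hy0 := hm.trans_le hy
  have hx0 := hm.trans_le hx
  rw [abs_of_nonneg (sub_nonneg.2 (Real.log_le_log hy0 hxy)),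
    ← Real.log_div hx0.ne' hy0.ne']
  rw [abs_of_nonneg (sub_nonneg.2 hxy)] at h
  calc Real.log (x / y) ≤ x / y - 1 := Real.log_le_sub_one_of_pos (by positivity)
    _ = (x - y) / y := by field_simp
    _ ≤ ε / m := div_le_div₀ ((sub_nonneg.2 hxy).trans h) h hm hy

/-! ### From mixing to summable level sums -/

variable {α c₀ : ℝ} {Δ : ℕ}

theorem exp_logRatio_succ_mem_uIcc (hlam : 0 < lam) (ℓ : ℕ) (s : ℝ) (x : X) :
    Real.exp (logRatio st lam r (ℓ + 1) s x) ∈ Set.uIcc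
      (lam * ∏ c, branchRec st lam (fun _ => 0) ℓ (st x c))
      (lam * ∏ c, branchRec st lam (fun _ => 1) ℓ (st x c)) := by
  have hβ : ∀ y, 0 ≤ (fun y => 1 / (1 + Real.exp (s + r y))) y := fun y => by positivity
  have hβ1 : ∀ y, (fun y => 1 / (1 + Real.exp (s + r y))) y ≤ 1 := fun y => by
    have := Real.exp_pos (s + r y)
    simp only
    rw [div_le_one (by positivity)]
    linarith
  rw [exp_logRatio_succ st hlam]
  simp only [one_div_one_add_exp_logRatio st hlam]
  have key : ∀ {β γ : X → ℝ}, (∀ y, 0 ≤ β y) →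
      (∀ y, branchRec st lam β ℓ y ≤ branchRec st lam γ ℓ y) →
      lam * ∏ c, branchRec st lam β ℓ (st x c) ≤ lam * ∏ c, branchRec st lam γ ℓ (st x c) :=
    fun hβ h => mul_le_mul_of_nonneg_left (Finset.prod_le_prod
      (fun c _ => branchRec_nonneg st hlam hβ ℓ (st x c)) fun c _ => h _) hlam.le
  rcases branchRec_between st hlam hβ hβ1 ℓ with h | h
  · exact Set.mem_uIcc.2 (Or.inl ⟨key (fun _ => le_rfl) fun y => (h y).1,
      key hβ fun y => (h y).2⟩)
  · exact Set.mem_uIcc.2 (Or.inr ⟨key (fun _ => zero_le_one) fun y => (h y).1,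
      key hβ fun y => (h y).2⟩)

/-- Two unfoldings are needed: then the children's vacancy probabilities are themselves outputs of
the recursion and at least `1 / (1 + lam)`. After one unfolding they are shifted boundary values,
with no lower bound uniform in `s`. -/
theorem le_exp_logRatio (hlam : 0 < lam) (hC : ∀ x, Fintype.card (C x) ≤ Δ) (ℓ : ℕ) (s : ℝ)
    (x : X) : lam * (1 / (1 + lam)) ^ Δ ≤ Real.exp (logRatio st lam r (ℓ + 2) s x) := by
  have hβ : ∀ y, 0 ≤ (fun y => 1 / (1 + Real.exp (s + r y))) y := fun y => by positivity
  have hβ1 : ∀ y, (fun y => 1 / (1 + Real.exp (s + r y))) y ≤ 1 := fun y => by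
    have := Real.exp_pos (s + r y)
    simp only
    rw [div_le_one (by positivity)]
    linarith
  rw [exp_logRatio_succ st hlam]
  simp only [one_div_one_add_exp_logRatio st hlam]
  refine mul_le_mul_of_nonneg_left ?_ hlam.le
  calc (1 / (1 + lam)) ^ Δ ≤ (1 / (1 + lam)) ^ Fintype.card (C x) :=
        pow_le_pow_of_le_one (by positivity)
          ((div_le_one (by positivity)).2 (by linarith)) (hC x)
    _ = ∏ _c : C x, 1 / (1 + lam) := by simp
    _ ≤ _ := Finset.prod_le_prod (fun _ _ => by positivity)
        fun c _ => le_branchRec_succ st hlam hβ hβ1 ℓ (st x c)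

theorem abs_logRatio_sub_le (hlam : 0 < lam) (hC : ∀ x, Fintype.card (C x) ≤ Δ) {ℓ : ℕ} {ε : ℝ}
    (x : X)
    (hmix : |lam * ∏ c, branchRec st lam (fun _ => 0) (ℓ + 1) (st x c) -
      lam * ∏ c, branchRec st lam (fun _ => 1) (ℓ + 1) (st x c)| ≤ ε) (s t : ℝ) :
    |logRatio st lam r (ℓ + 2) s x - logRatio st lam r (ℓ + 2) t x| ≤
      ε / (lam * (1 / (1 + lam)) ^ Δ) := by
  have := abs_log_sub_log_le (by positivity) (le_exp_logRatio st (r := r) hlam hC ℓ s x)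
    (le_exp_logRatio st (r := r) hlam hC ℓ t x)
    ((Set.abs_sub_le_of_uIcc_subset_uIcc (Set.uIcc_subset_uIcc
      (exp_logRatio_succ_mem_uIcc st hlam (ℓ + 1) t x)
      (exp_logRatio_succ_mem_uIcc st hlam (ℓ + 1) s x))).trans
        ((abs_sub_comm _ _).trans_le hmix))
  simpa using this

/-- The two bounds support each other: those at level `ℓ` give the derivative bound at `ℓ + 1`,
which together with mixing gives the bound on the level sum at `ℓ + 1`. The three conditions on `c₀`
serve level 0, level 1 and the levels from 2 on. -/
theorem levelInfluence_le (hlam : 0 < lam) (hC : ∀ x, Fintype.card (C x) ≤ Δ) (hα : 0 < α)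
    (hc : 1 ≤ c₀) (hcΔ : Δ ≤ c₀ * α)
    (hmix : ∀ ℓ x, |lam * ∏ c, branchRec st lam (fun _ => 0) ℓ (st x c) -
      lam * ∏ c, branchRec st lam (fun _ => 1) ℓ (st x c)| ≤
        c₀ * (lam * (1 / (1 + lam)) ^ Δ) / 2 * α ^ (ℓ + 1)) (ℓ : ℕ) (s : ℝ) (x : X) :
    levelInfluence st lam r ℓ s x ≤ c₀ * α ^ ℓ * ∏ j ∈ Finset.range ℓ, (1 + c₀ * α ^ j) ∧
    |levelInfluenceDeriv st lam r ℓ s x| ≤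
      (∏ j ∈ Finset.range ℓ, (1 + c₀ * α ^ j)) * levelInfluence st lam r ℓ s x := by
  induction ℓ generalizing s x with
  | zero => simp [levelInfluence, levelInfluenceDeriv, hc]
  | succ ℓ ih =>
    have hK : ∀ n, 1 ≤ ∏ j ∈ Finset.range n, (1 + c₀ * α ^ j) := fun n =>
      Finset.prod_induction _ (fun y => (1 : ℝ) ≤ y) (fun _ _ => one_le_mul_of_one_le_of_one_le)
        le_rfl fun j _ => by
          have : 0 < c₀ * α ^ j := by positivity
          linarith
    have hder : ∀ s x, |levelInfluenceDeriv st lam r (ℓ + 1) s x| ≤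
        (∏ j ∈ Finset.range (ℓ + 1), (1 + c₀ * α ^ j)) *
          levelInfluence st lam r (ℓ + 1) s x := fun s x => by
      refine (abs_levelInfluenceDeriv_succ_le st (fun x => (ih s x).2) (fun x => (ih s x).1)
        x).trans_eq ?_
      rw [Finset.prod_range_succ]
      ring
    refine ⟨?_, hder s x⟩
    -- Level 1 has no uniform lower bound on the ratio, so mixing of ratios does not pass to
    -- logarithms; the degree bound replaces it.
    rcases ℓ with _ | ℓ
    · calc levelInfluence st lam r 1 s x ≤ ∑ _c : C x, (1 : ℝ) :=
            Finset.sum_le_sum fun c _ => by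
              simpa [levelInfluence] using Real.sigmoid_le_one _
        _ = Fintype.card (C x) := by simp
        _ ≤ Δ := by exact_mod_cast hC x
        _ ≤ c₀ * α := hcΔ
        _ ≤ _ := by
          rw [zero_add, pow_one]
          exact le_mul_of_one_le_right (by positivity) (hK 1)
    -- The oscillation argument is applied to `(-1) ^ (ℓ + 2)` times the log-ratio, whose derivative
    -- is the level sum without sign.
    · have hsq : ((-1 : ℝ) ^ (ℓ + 2)) * (-1) ^ (ℓ + 2) = 1 := by
        rw [← mul_pow]; simp
      have := deriv_le_of_abs_deriv_le (s := s) (hK (ℓ + 2))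
        (fun t => ((hasDerivAt_logRatio st (lam := lam) (r := r) (ℓ + 2) t x).const_mul
          ((-1) ^ (ℓ + 2))).congr_deriv (by rw [← mul_assoc, hsq, one_mul]))
        (fun t => hasDerivAt_levelInfluence st (ℓ + 2) t x) (fun t => hder t x)
        (ε := c₀ / 2 * α ^ (ℓ + 2)) (fun t u => by
          rw [← mul_sub, abs_mul, abs_pow, abs_neg, abs_one, one_pow, one_mul]
          refine (abs_logRatio_sub_le st hlam hC x (hmix (ℓ + 1) x) t u).trans_eq ?_
          field_simp)
      refine this.trans_eq ?_
      ring

theorem exists_sum_levelInfluence_le {lam : ℝ} (hlam : 0 < lam) (Δ : ℕ) {α c : ℝ} (hα : 0 ≤ α)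
    (hα1 : α < 1) (hc : 0 < c) :
    ∃ K : ℝ, ∀ (X : Type*) (C : X → Type*) [∀ x, Fintype (C x)] (st : ∀ x, C x → X) (r : X → ℝ),
      (∀ x, Fintype.card (C x) ≤ Δ) →
      (∀ ℓ x, |lam * ∏ c, branchRec st lam (fun _ => 0) ℓ (st x c) -
        lam * ∏ c, branchRec st lam (fun _ => 1) ℓ (st x c)| ≤ c * α ^ (ℓ + 1)) →
      ∀ n s x, ∑ ℓ ∈ Finset.range n, levelInfluence st lam r ℓ s x ≤ K := by
  -- Since `α` may be 0, a positive rate is substituted; `Δ / γ` is used below.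
  set γ := max α (1 / 2)
  have hγ : 0 < γ := lt_max_of_lt_right (by norm_num)
  have hγ1 : γ < 1 := max_lt hα1 (by norm_num)
  set m := lam * (1 / (1 + lam)) ^ Δ with hm
  have hm0 : 0 < m := by positivity
  set c₀ := 1 + Δ / γ + 2 * c / m with hc₀
  have h1 : 0 ≤ Δ / γ := by positivity
  have h2 : 0 < 2 * c / m := by positivity
  have hc₀1 : 1 ≤ c₀ := by linarith
  refine ⟨Real.exp (c₀ / (1 - γ)), fun X C _ st r hC hmix n s x => ?_⟩
  have key := levelInfluence_le st (r := r) (lam := lam) (α := γ) (c₀ := c₀) hlam hC hγ hc₀1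
    (by
      have : Δ / γ ≤ c₀ := by linarith
      rwa [div_le_iff₀ hγ] at this)
    (fun ℓ x => (hmix ℓ x).trans (by
      have h3 : α ^ (ℓ + 1) ≤ γ ^ (ℓ + 1) := pow_le_pow_left₀ hα (le_max_left _ _) _
      have h4 : c ≤ c₀ * m / 2 := by
        have : 2 * c / m ≤ c₀ := by linarith
        rw [div_le_iff₀ hm0] at this
        linarith
      rw [← hm]
      exact mul_le_mul h4 h3 (by positivity) (by positivity)))
  calc ∑ ℓ ∈ Finset.range n, levelInfluence st lam r ℓ s x
      ≤ ∑ ℓ ∈ Finset.range n, c₀ * γ ^ ℓ * ∏ j ∈ Finset.range ℓ, (1 + c₀ * γ ^ j) :=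
        Finset.sum_le_sum fun ℓ _ => (key ℓ s x).1
    _ ≤ ∏ j ∈ Finset.range n, (1 + c₀ * γ ^ j) := by
        -- The `ℓ`-th summand is the difference of consecutive partial products, so the sum
        -- telescopes.
        induction n with
        | zero => simp
        | succ n ih =>
          rw [Finset.sum_range_succ, Finset.prod_range_succ]
          linarith
    _ ≤ ∏ j ∈ Finset.range n, Real.exp (c₀ * γ ^ j) :=
        Finset.prod_le_prod (fun j _ => by positivity) fun j _ => by
          rw [add_comm]; exact Real.add_one_le_exp _
    _ = Real.exp (∑ j ∈ Finset.range n, c₀ * γ ^ j) := (Real.exp_sum _ _).symm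
    _ ≤ Real.exp (c₀ / (1 - γ)) := by
        rw [Real.exp_le_exp, ← Finset.mul_sum, div_eq_mul_inv, ← tsum_geometric_of_lt_one hγ.le hγ1]
        exact mul_le_mul_of_nonneg_left ((summable_geometric_of_lt_one hγ.le hγ1).sum_le_tsum _
          fun _ _ => by positivity) (by positivity)

end Branching

/-! ### The hard-core model on the tree of self-avoiding walks -/

section SAWTree

variable {V : Type u} [LinearOrder V] {G : SimpleGraph V}

/-- The distance from the root. -/
def SAWVertex.depth : ∀ {A : Set V} {v : V}, SAWVertex G A v → ℕ
  | _, _, .root => 0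
  | _, _, .child _ _ _ p => p.depth + 1

theorem SAWVertex.Parent.depth_eq {A : Set V} {v : V} {x y : SAWVertex G A v}
    (h : SAWVertex.Parent x y) : y.depth = x.depth + 1 := by
  induction h with
  | root => rfl
  | child w hA hw p q h ih => simp [SAWVertex.depth, ih]

theorem sawTree_adj {A : Set V} {v : V} {x y : SAWVertex G A v} :
    (sawTree G A v).Adj x y ↔ SAWVertex.Parent x y ∨ SAWVertex.Parent y x := by
  rw [sawTree, SimpleGraph.fromRel_adj, and_iff_right_iff_imp]
  rintro (h | h) rfl <;> simpa using h.depth_eq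

theorem isIndepSet_sawTree_iff {A : Set V} {v : V} {s : Set (SAWVertex G A v)} :
    (sawTree G A v).IsIndepSet s ↔ ∀ x ∈ s, ∀ y ∈ s, ¬ SAWVertex.Parent x y := by
  refine ⟨fun h x hx y hy hp => ?_, fun h x hx y hy _ hadj => ?_⟩
  · have hadj := sawTree_adj.2 (Or.inl hp)
    exact h hx hy hadj.ne hadj
  · rcases sawTree_adj.1 hadj with hp | hp
    · exact h x hx y hy hp
    · exact h y hy x hx hp

theorem depth_le_depth_add_length {A : Set V} {v : V} {x y : SAWVertex G A v}
    (p : (sawTree G A v).Walk x y) : y.depth ≤ x.depth + p.length := by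
  induction p with
  | nil => simp
  | cons h p ih =>
    rw [SimpleGraph.Walk.length_cons]
    rcases sawTree_adj.1 h with h | h <;> have := h.depth_eq <;> omega

theorem exists_walk_length_eq_depth {A : Set V} {v : V} (x : SAWVertex G A v) :
    ∃ p : (sawTree G A v).Walk .root x, p.length = x.depth := by
  induction x with
  | root => exact ⟨.nil, rfl⟩
  | @child A v w hA hw x ih =>
    obtain ⟨p, hp⟩ := ih
    let φ : sawTree G (A \ {x | x = v ∨ (G.Adj v x ∧ x < w)}) w →g sawTree G A v :=
      ⟨SAWVertex.child w hA hw, fun {a b} h => sawTree_adj.2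
        ((sawTree_adj.1 h).imp (SAWVertex.Parent.child w hA hw a b)
          (SAWVertex.Parent.child w hA hw b a))⟩
    refine ⟨.cons (sawTree_adj.2 (Or.inl (SAWVertex.Parent.root w hA hw))) (p.map φ), ?_⟩
    simp [SAWVertex.depth, hp]

/-- Every edge changes the depth by exactly one, so no walk from the root is shorter than the
descending one. -/
theorem sawTree_dist_root {A : Set V} {v : V} (x : SAWVertex G A v) :
    (sawTree G A v).dist .root x = x.depth := by
  obtain ⟨p, hp⟩ := exists_walk_length_eq_depth x
  refine le_antisymm (hp ▸ SimpleGraph.dist_le p) ?_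
  obtain ⟨q, hq⟩ := SimpleGraph.Reachable.exists_walk_length_eq_dist ⟨p⟩
  have := depth_le_depth_add_length q
  rw [← hq]
  simpa [SAWVertex.depth] using this

/-- The children of the root of `T_SAW(G[A], v)`. -/
abbrev SAWChild (G : SimpleGraph V) (A : Set V) (v : V) : Type u := {w : V // w ∈ A ∧ G.Adj v w}

noncomputable instance SAWChild.instFintype [Finite V] (G : SimpleGraph V) (A : Set V) (v : V) :
    Fintype (SAWChild G A v) :=
  Fintype.ofFinite _

/-- The subtree of `T_SAW(G[A], v)` at a child of the root. -/
abbrev SAWSubtree (G : SimpleGraph V) (A : Set V) (v : V) (c : SAWChild G A v) : Type u :=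
  SAWVertex G (A \ {x | x = v ∨ (G.Adj v x ∧ x < c.1)}) c.1

variable {A : Set V} {v : V}

/-- The inclusion of the subtrees at the children of the root. -/
def SAWVertex.ofSubtree (x : Σ c : SAWChild G A v, SAWSubtree G A v c) : SAWVertex G A v :=
  .child x.1.1 x.1.2.1 x.1.2.2 x.2

theorem SAWVertex.ofSubtree_injective :
    Function.Injective (SAWVertex.ofSubtree (G := G) (A := A) (v := v)) := by
  rintro ⟨⟨w, _, _⟩, p⟩ ⟨⟨w', _, _⟩, p'⟩ h
  simp only [SAWVertex.ofSubtree, SAWVertex.child.injEq] at h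
  obtain ⟨rfl, h⟩ := h
  cases h
  rfl

/-- The boundary condition with constant value on the sphere of radius `ℓ` around the root. -/
def levelBoundary (ℓ : ℕ) (b : Bool) (G : SimpleGraph V) (A : Set V) (v : V) :
    BoundaryCondition (sawTree G A v) where
  dom := {x | (sawTree G A v).dist .root x = ℓ}
  val := fun _ => if b then 1 else 0
  -- Edges join consecutive levels, so a sphere is independent and may be fully occupied.
  indep := isIndepSet_sawTree_iff.2 fun x ⟨hx, _⟩ y ⟨hy, _⟩ h => by
    have := h.depth_eq
    simp only [Set.mem_ofPred_eq, sawTree_dist_root] at hx hy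
    omega

theorem mem_inSet_levelBoundary {ℓ : ℕ} {b : Bool} {x : SAWVertex G A v} :
    x ∈ (levelBoundary ℓ b G A v).inSet ↔ x.depth = ℓ ∧ b := by
  cases b <;> simp [levelBoundary, BoundaryCondition.inSet, sawTree_dist_root]

variable [Finite V]

/-- The union of sets of vertices of the subtrees. -/
noncomputable def joinSubtrees (f : ∀ c : SAWChild G A v, Finset (SAWSubtree G A v c)) :
    Finset (SAWVertex G A v) :=
  (Finset.univ.sigma f).map ⟨SAWVertex.ofSubtree, SAWVertex.ofSubtree_injective⟩

open Classical in
/-- The part of a set of vertices in the subtree at a child of the root. -/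
noncomputable def restrictSubtree (J : Finset (SAWVertex G A v)) (c : SAWChild G A v) :
    Finset (SAWSubtree G A v c) :=
  Finset.univ.filter fun p => SAWVertex.ofSubtree ⟨c, p⟩ ∈ J

theorem mem_restrictSubtree {J : Finset (SAWVertex G A v)} {c : SAWChild G A v}
    {p : SAWSubtree G A v c} : p ∈ restrictSubtree J c ↔ SAWVertex.ofSubtree ⟨c, p⟩ ∈ J := by
  simp [restrictSubtree]

theorem ofSubtree_mem_joinSubtrees {f : ∀ c : SAWChild G A v, Finset (SAWSubtree G A v c)}
    {c : SAWChild G A v} {p : SAWSubtree G A v c} :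
    SAWVertex.ofSubtree ⟨c, p⟩ ∈ joinSubtrees f ↔ p ∈ f c := by
  rw [joinSubtrees, Finset.mem_map]
  constructor
  · rintro ⟨y, hy, h⟩
    have := SAWVertex.ofSubtree_injective h
    subst this
    simpa using hy
  · intro h
    exact ⟨⟨c, p⟩, by simpa using h, rfl⟩

theorem root_notMem_joinSubtrees (f : ∀ c : SAWChild G A v, Finset (SAWSubtree G A v c)) :
    SAWVertex.root ∉ joinSubtrees f := by
  simp [joinSubtrees, SAWVertex.ofSubtree]

theorem card_joinSubtrees (f : ∀ c : SAWChild G A v, Finset (SAWSubtree G A v c)) :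
    (joinSubtrees f).card = ∑ c, (f c).card := by
  rw [joinSubtrees, Finset.card_map, Finset.card_sigma]

theorem restrictSubtree_joinSubtrees
    (f : ∀ c : SAWChild G A v, Finset (SAWSubtree G A v c)) :
    restrictSubtree (joinSubtrees f) = f := by
  ext c p
  rw [mem_restrictSubtree, ofSubtree_mem_joinSubtrees]

theorem joinSubtrees_restrictSubtree {J : Finset (SAWVertex G A v)}
    (hJ : SAWVertex.root ∉ J) : joinSubtrees (restrictSubtree J) = J := by
  ext (_ | ⟨w, hA, hw, p⟩)
  · simp [root_notMem_joinSubtrees, hJ]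
  · exact (ofSubtree_mem_joinSubtrees (c := ⟨w, hA, hw⟩) (p := p)).trans mem_restrictSubtree

open Classical in
theorem restrictSubtree_insert_root (J : Finset (SAWVertex G A v)) :
    restrictSubtree (insert .root J) = restrictSubtree J := by
  ext c p
  simp [mem_restrictSubtree, SAWVertex.ofSubtree]

/-- An independent set of the tree that contains all or none (according to `b`) of the vertices
at distance `ℓ` from the root. -/
def IsLevelIndep (ℓ : ℕ) (b : Bool) (J : Finset (SAWVertex G A v)) : Prop :=
  (∀ x ∈ J, ∀ y ∈ J, ¬ SAWVertex.Parent x y) ∧ ∀ x : SAWVertex G A v, x.depth = ℓ → (x ∈ J ↔ b)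

/-- The subtrees interact only through the root, so the weights factor over the children once the
state of the root is fixed. -/
theorem isLevelIndep_succ_iff {ℓ : ℕ} {b : Bool} {J : Finset (SAWVertex G A v)} :
    IsLevelIndep (ℓ + 1) b J ↔ (∀ c, IsLevelIndep ℓ b (restrictSubtree J c)) ∧
      (SAWVertex.root ∈ J → ∀ c, SAWVertex.root ∉ restrictSubtree J c) := by
  simp only [IsLevelIndep, mem_restrictSubtree]
  constructor
  · rintro ⟨h1, h2⟩
    refine ⟨fun c => ⟨fun p hp q hq h => ?_, fun p hp => ?_⟩, fun hr c hc => ?_⟩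
    · exact h1 _ hp _ hq (SAWVertex.Parent.child _ c.2.1 c.2.2 _ _ h)
    · exact h2 _ (by simp [SAWVertex.ofSubtree, SAWVertex.depth, hp])
    · exact h1 _ hr _ hc (SAWVertex.Parent.root c.1 c.2.1 c.2.2)
  · rintro ⟨h1, h2⟩
    refine ⟨fun x hx y hy h => ?_, fun x hx => ?_⟩
    · cases h with
      | root w hA hw => exact h2 hx ⟨w, hA, hw⟩ hy
      | child w hA hw p q h => exact (h1 ⟨w, hA, hw⟩).1 p hx q hy h
    · cases x with
      | root => simp [SAWVertex.depth] at hx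
      | child w hA hw p => exact (h1 ⟨w, hA, hw⟩).2 p (by simpa [SAWVertex.depth] using hx)

open Classical in
/-- The sum of `lam ^ |J|` over the sets `J` as in `IsLevelIndep` that satisfy `P`. -/
noncomputable def levelWeight (G : SimpleGraph V) (lam : ℝ) (ℓ : ℕ) (b : Bool) (A : Set V) (v : V)
    (P : Finset (SAWVertex G A v) → Prop) : ℝ :=
  ∑ J ∈ (Finset.univ : Finset (Finset (SAWVertex G A v))).filter
    (fun J => IsLevelIndep ℓ b J ∧ P J), lam ^ J.card

variable {lam : ℝ} (ℓ : ℕ) (b : Bool)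

theorem levelWeight_add_not (P : Finset (SAWVertex G A v) → Prop) :
    levelWeight G lam ℓ b A v P + levelWeight G lam ℓ b A v (fun J => ¬ P J) =
      levelWeight G lam ℓ b A v fun _ => True := by
  classical
  simp only [levelWeight]
  rw [← Finset.sum_filter_add_sum_filter_not (Finset.univ.filter fun J => IsLevelIndep ℓ b J ∧ True)
    P, Finset.filter_filter, Finset.filter_filter]
  simp

theorem levelWeight_true_pos (hlam : 0 < lam) :
    0 < levelWeight G lam ℓ b A v fun _ => True := by
  classical
  refine Finset.sum_pos (fun _ _ => by positivity)
    ⟨Finset.univ.filter fun x => x.depth = ℓ ∧ b = true, ?_⟩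
  simp only [Finset.mem_filter, Finset.mem_univ, true_and, and_true, IsLevelIndep]
  refine ⟨fun x hx y hy h => ?_, fun x hx => by simp [hx]⟩
  have := h.depth_eq
  omega

theorem levelWeight_succ_root_notMem :
    levelWeight G lam (ℓ + 1) b A v (fun J => SAWVertex.root ∉ J) =
      ∏ c : SAWChild G A v, levelWeight G lam ℓ b
        (A \ {x | x = v ∨ (G.Adj v x ∧ x < c.1)}) c.1 (fun _ => True) := by
  classical
  simp only [levelWeight, and_true]
  rw [Finset.prod_univ_sum]
  refine Finset.sum_bij' (fun J _ => restrictSubtree J) (fun f _ => joinSubtrees f)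
    (fun J hJ => ?_) (fun f hf => ?_) (fun J hJ => ?_) (fun f hf => ?_) (fun J hJ => ?_)
  · simp only [Finset.mem_filter, Finset.mem_univ, true_and, isLevelIndep_succ_iff] at hJ
    simpa using hJ.1.1
  · simp only [Finset.mem_filter, Finset.mem_univ, true_and, isLevelIndep_succ_iff,
      restrictSubtree_joinSubtrees]
    exact ⟨⟨by simpa using hf, fun h => (root_notMem_joinSubtrees f h).elim⟩,
      root_notMem_joinSubtrees f⟩
  · simp only [Finset.mem_filter] at hJ
    exact joinSubtrees_restrictSubtree hJ.2.2
  · exact restrictSubtree_joinSubtrees f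
  · simp only [Finset.mem_filter] at hJ
    rw [Finset.prod_pow_eq_pow_sum, ← card_joinSubtrees, joinSubtrees_restrictSubtree hJ.2.2]

theorem levelWeight_succ_root_mem :
    levelWeight G lam (ℓ + 1) b A v (fun J => SAWVertex.root ∈ J) =
      lam * ∏ c : SAWChild G A v, levelWeight G lam ℓ b
        (A \ {x | x = v ∨ (G.Adj v x ∧ x < c.1)}) c.1 (fun J => SAWVertex.root ∉ J) := by
  classical
  simp only [levelWeight]
  rw [Finset.prod_univ_sum, Finset.mul_sum]
  refine Finset.sum_bij' (fun J _ => restrictSubtree J)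
    (fun f _ => insert .root (joinSubtrees f))
    (fun J hJ => ?_) (fun f hf => ?_) (fun J hJ => ?_) (fun f hf => ?_) (fun J hJ => ?_)
  · simp only [Finset.mem_filter, Finset.mem_univ, true_and, isLevelIndep_succ_iff] at hJ
    simpa using fun w hA hw => ⟨hJ.1.1 ⟨w, hA, hw⟩, hJ.1.2 hJ.2 ⟨w, hA, hw⟩⟩
  · simp only [Finset.mem_filter, Finset.mem_univ, true_and, isLevelIndep_succ_iff,
      restrictSubtree_insert_root, restrictSubtree_joinSubtrees]
    simp only [Fintype.mem_piFinset, Finset.mem_filter, Finset.mem_univ, true_and] at hf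
    exact ⟨⟨fun c => (hf c).1, fun _ c => (hf c).2⟩, Finset.mem_insert_self _ _⟩
  · simp only [Finset.mem_filter] at hJ
    have : J = insert .root (J.erase .root) := (Finset.insert_erase hJ.2.2).symm
    conv_rhs => rw [this]
    congr 1
    conv_lhs => rw [this]
    rw [restrictSubtree_insert_root, joinSubtrees_restrictSubtree (by simp)]
  · simp only [restrictSubtree_insert_root, restrictSubtree_joinSubtrees]
  · simp only [Finset.mem_filter] at hJ
    have : J = insert .root (J.erase .root) := (Finset.insert_erase hJ.2.2).symm
    rw [Finset.prod_pow_eq_pow_sum, ← card_joinSubtrees, ← pow_succ']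
    conv_rhs => rw [this]
    rw [restrictSubtree_insert_root, joinSubtrees_restrictSubtree (by simp),
      Finset.card_erase_add_one hJ.2.2]

/-- A vertex set together with one of its elements. -/
abbrev SAWState (V : Type u) : Type u := {x : Set V × V // x.2 ∈ x.1}

/-- The pair `(G[A'], w)` whose tree of self-avoiding walks is the subtree of the tree of
`(G[A], v)` at the child `w`. -/
def sawStep (G : SimpleGraph V) (x : SAWState V) (c : SAWChild G x.1.1 x.1.2) : SAWState V :=
  ⟨(x.1.1 \ {y | y = x.1.2 ∨ (G.Adj x.1.2 y ∧ y < c.1)}, c.1), c.2.1, by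
    rintro (h | h)
    · exact c.2.2.ne h.symm
    · exact lt_irrefl _ h.2⟩

/-- The vertices below level `ℓ` are still present, but at level 0 the state of the root is
prescribed, so the quotient is 0 or 1 whatever hangs below. Prescribed occupation (`b = true`) is
vacancy probability 0. -/
theorem levelWeight_div (hlam : 0 < lam) (x : SAWState V) :
    levelWeight G lam ℓ b x.1.1 x.1.2 (fun J => SAWVertex.root ∉ J) /
      levelWeight G lam ℓ b x.1.1 x.1.2 (fun _ => True) =
    branchRec (sawStep G) lam (fun _ => if b then 0 else 1) ℓ x := by
  classical
  induction ℓ generalizing x with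
  | zero =>
    rw [branchRec]
    have hroot : ∀ J : Finset (SAWVertex G x.1.1 x.1.2),
        IsLevelIndep 0 b J → (SAWVertex.root ∈ J ↔ b) := fun J hJ => hJ.2 _ rfl
    have hpos := levelWeight_true_pos (G := G) (A := x.1.1) (v := x.1.2) 0 b hlam
    cases b
    · have : levelWeight G lam 0 false x.1.1 x.1.2 (fun J => SAWVertex.root ∉ J) =
          levelWeight G lam 0 false x.1.1 x.1.2 (fun _ => True) := by
        simp only [levelWeight]
        congr 1
        refine Finset.filter_congr fun J _ => and_congr_right fun hJ => ?_
        simp [hroot J hJ]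
      simp [this, hpos.ne']
    · have : levelWeight G lam 0 true x.1.1 x.1.2 (fun J => SAWVertex.root ∉ J) = 0 := by
        simp only [levelWeight]
        refine Finset.sum_eq_zero fun J hJ => ?_
        rw [Finset.mem_filter] at hJ
        exact (hJ.2.2 ((hroot J hJ.2.1).2 rfl)).elim
      simp [this]
  | succ ℓ ih =>
    have hne : ∀ c : SAWChild G x.1.1 x.1.2, levelWeight G lam ℓ b
        (x.1.1 \ {y | y = x.1.2 ∨ (G.Adj x.1.2 y ∧ y < c.1)}) c.1 (fun _ => True) ≠ 0 :=
      fun c => (levelWeight_true_pos ℓ b hlam).ne'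
    rw [branchRec, ← levelWeight_add_not (ℓ + 1) b fun J => SAWVertex.root ∈ J,
      levelWeight_succ_root_mem, levelWeight_succ_root_notMem]
    simp only [← ih]
    simp only [sawStep]
    rw [Finset.prod_div_distrib]
    have hprod := Finset.prod_ne_zero_iff.2 fun c (_ : c ∈ Finset.univ) => hne c
    field_simp
    rw [add_comm (lam * _)]
    rfl

open Classical in
-- `condPartition` does not count the occupied boundary vertices, while `levelWeight` does; this is
-- the power of `lam`. The event must ignore the sphere, since the bijection adds or removes its
-- vertices.
theorem condPartition_levelBoundary {P : Finset (SAWVertex G A v) → Prop}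
    (hP : ∀ I J : Finset (SAWVertex G A v), (∀ x, x.depth ≠ ℓ → (x ∈ I ↔ x ∈ J)) → (P I ↔ P J)) :
    condPartition (sawTree G A v) (levelBoundary ℓ b G A v) lam P *
      lam ^ (Finset.univ.filter fun x : SAWVertex G A v => x.depth = ℓ ∧ b).card =
    levelWeight G lam ℓ b A v P := by
  set S := Finset.univ.filter fun x : SAWVertex G A v => x.depth = ℓ ∧ b with hS
  have hin : (levelBoundary ℓ b G A v).inSet = (S : Set _) := by
    ext x
    simp [mem_inSet_levelBoundary, hS]
  have hdom : ∀ I : Finset (SAWVertex G A v), Disjoint (I : Set _) (levelBoundary ℓ b G A v).dom ↔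
      ∀ x ∈ I, x.depth ≠ ℓ := fun I => by
    simp [levelBoundary, sawTree_dist_root, Set.disjoint_left]
  rw [condPartition, levelWeight, Finset.sum_mul]
  simp only [hin, hdom, ← Finset.coe_union, isIndepSet_sawTree_iff]
  refine Finset.sum_bij' (fun I _ => I ∪ S) (fun J _ => J.filter fun x => x.depth ≠ ℓ)
    (fun I hI => ?_) (fun J hJ => ?_) (fun I hI => ?_) (fun J hJ => ?_) (fun I hI => ?_)
  · simp only [Finset.mem_filter, Finset.mem_univ, true_and] at hI ⊢
    refine ⟨⟨fun x hx y hy => hI.2.1 x hx y hy, fun x hx => ?_⟩,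
      (hP _ _ fun x hx => ?_).1 hI.2.2⟩
    · have : x ∉ I := fun h => hI.1 x h hx
      simp [this, hS, hx]
    · simp [hS, hx]
  · simp only [Finset.mem_filter, Finset.mem_univ, true_and] at hJ ⊢
    have hsub : J.filter (fun x => x.depth ≠ ℓ) ∪ S ⊆ J := by
      intro x hx
      simp only [Finset.mem_union, Finset.mem_filter, hS, Finset.mem_univ, true_and] at hx
      exact hx.elim And.left fun h => (hJ.1.2 x h.1).2 h.2
    refine ⟨fun x hx => hx.2, fun x hx y hy => hJ.1.1 x (hsub hx) y (hsub hy),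
      (hP _ _ fun x hx => ?_).1 hJ.2⟩
    simp [hx]
  · simp only [Finset.mem_filter, Finset.mem_univ, true_and] at hI
    ext x
    simp only [Finset.mem_filter, Finset.mem_union, hS, Finset.mem_univ, true_and]
    have := hI.1 x
    tauto
  · simp only [Finset.mem_filter, Finset.mem_univ, true_and] at hJ
    ext x
    simp only [Finset.mem_filter, Finset.mem_union, hS, Finset.mem_univ, true_and]
    have := hJ.1.2 x
    tauto
  · simp only [Finset.mem_filter, Finset.mem_univ, true_and] at hI
    rw [← pow_add, Finset.card_union_of_disjoint]
    rw [Finset.disjoint_left]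
    intro x hx hxS
    simp only [hS, Finset.mem_filter] at hxS
    exact hI.1 x hx hxS.2.1

theorem condRatio_levelBoundary (hlam : 0 < lam) (x : SAWState V) :
    condRatio (sawTree G x.1.1 x.1.2) (levelBoundary (ℓ + 1) b G x.1.1 x.1.2) .root lam =
      lam * ∏ c, branchRec (sawStep G) lam (fun _ => if b then 0 else 1) ℓ (sawStep G x c) := by
  classical
  have hroot : (SAWVertex.root : SAWVertex G x.1.1 x.1.2).depth ≠ ℓ + 1 := by
    simp [SAWVertex.depth]
  -- The weight of the sphere is common to numerator and denominator.
  rw [condRatio, ← mul_div_mul_right _ _ (pow_pos hlam _).ne',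
    condPartition_levelBoundary (ℓ + 1) b fun I J h => h _ hroot,
    condPartition_levelBoundary (ℓ + 1) b fun I J h => not_congr (h _ hroot),
    levelWeight_succ_root_mem, levelWeight_succ_root_notMem, mul_div_assoc,
    ← Finset.prod_div_distrib]
  congr 1
  exact Finset.prod_congr rfl fun c _ => levelWeight_div ℓ b hlam (sawStep G x c)

end SAWTree

/-! ### Marginals and influences of the hard-core model on induced subgraphs -/

theorem sum_filter_le_sub_filter_lt {V : Type*} [LinearOrder V] (S : Finset V)
    (f : Finset V → ℝ) :
    ∑ w ∈ S, (f (S.filter (· ≤ w)) - f (S.filter (· < w))) = f S - f ∅ := by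
  induction S using Finset.induction_on_max with
  | empty => simp
  | insert a S ha ih =>
    have haS : a ∉ S := fun h => lt_irrefl _ (ha a h)
    rw [Finset.sum_insert haS]
    have h1 : (insert a S).filter (· ≤ a) = insert a S :=
      Finset.filter_true_of_mem fun x hx => by
        rcases Finset.mem_insert.1 hx with rfl | hx
        · exact le_rfl
        · exact (ha x hx).le
    have h2 : (insert a S).filter (· < a) = S := by
      rw [Finset.filter_insert, if_neg (lt_irrefl _), Finset.filter_true_of_mem ha]
    have h3 : ∀ w ∈ S, f ((insert a S).filter (· ≤ w)) - f ((insert a S).filter (· < w)) =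
        f (S.filter (· ≤ w)) - f (S.filter (· < w)) := fun w hw => by
      rw [Finset.filter_insert, if_neg (ha w hw).not_ge, Finset.filter_insert,
        if_neg (ha w hw).not_gt]
    rw [Finset.sum_congr rfl h3, ih, h1, h2]
    ring

section Marginals

variable {V : Type u} [Fintype V]

open Classical in
/-- The sum of `lam ^ |I|` over the independent sets `I ⊆ A` of `G` that satisfy `P`. -/
noncomputable def indepWeight (G : SimpleGraph V) (lam : ℝ) (A : Set V) (P : Finset V → Prop) :
    ℝ :=
  ∑ I ∈ (Finset.univ : Finset (Finset V)).filter
    (fun I : Finset V => (I : Set V) ⊆ A ∧ G.IsIndepSet (I : Set V) ∧ P I), lam ^ I.card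

/-- The probability that `u` is occupied in the hard-core model on `G[A]`. -/
noncomputable def marginal (G : SimpleGraph V) (lam : ℝ) (A : Set V) (u : V) : ℝ :=
  indepWeight G lam A (fun I => u ∈ I) / indepWeight G lam A fun _ => True

/-- The logarithm of the occupation ratio of `v` in the hard-core model on `G[A]`. -/
noncomputable def occupationLogRatio (G : SimpleGraph V) (lam : ℝ) (x : SAWState V) : ℝ :=
  Real.log (indepWeight G lam x.1.1 (fun I => x.1.2 ∈ I) /
    indepWeight G lam x.1.1 fun I => x.1.2 ∉ I)

variable {G : SimpleGraph V} {lam : ℝ} {A : Set V}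

theorem indepWeight_congr {P Q : Finset V → Prop} (h : ∀ I : Finset V, ↑I ⊆ A → (P I ↔ Q I)) :
    indepWeight G lam A P = indepWeight G lam A Q := by
  classical
  simp only [indepWeight]
  congr 1
  exact Finset.filter_congr fun I _ => and_congr_right fun hI => and_congr_right fun _ => h I hI

theorem indepWeight_and_add_and_not (P Q : Finset V → Prop) :
    indepWeight G lam A (fun I => P I ∧ Q I) + indepWeight G lam A (fun I => P I ∧ ¬ Q I) =
      indepWeight G lam A P := by
  classical
  simp only [indepWeight]
  rw [← Finset.sum_filter_add_sum_filter_not (Finset.univ.filter fun I : Finset V =>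
    (I : Set V) ⊆ A ∧ G.IsIndepSet (I : Set V) ∧ P I) Q, Finset.filter_filter,
    Finset.filter_filter]
  simp only [and_assoc]

theorem indepWeight_add_not (P : Finset V → Prop) :
    indepWeight G lam A P + indepWeight G lam A (fun I => ¬ P I) =
      indepWeight G lam A fun _ => True := by
  simpa using indepWeight_and_add_and_not (G := G) (lam := lam) (A := A) (fun _ => True) P

theorem indepWeight_and_notMem (v : V) (P : Finset V → Prop) :
    indepWeight G lam A (fun I => P I ∧ v ∉ I) = indepWeight G lam (A \ {v}) P := by
  classical
  simp only [indepWeight]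
  congr 1
  ext I
  simp only [Finset.mem_filter, Finset.mem_univ, true_and, Set.subset_sdiff,
    Set.disjoint_singleton_right, Finset.mem_coe]
  tauto

open Classical in
theorem indepWeight_and_mem {v : V} (hv : v ∈ A) (P : Finset V → Prop) :
    indepWeight G lam A (fun I => P I ∧ v ∈ I) =
      lam * indepWeight G lam (A \ {x | x = v ∨ G.Adj v x}) fun I => P (insert v I) := by
  simp only [indepWeight, Finset.mul_sum]
  refine Finset.sum_bij' (fun I _ => I.erase v) (fun I _ => insert v I)
    (fun I hI => ?_) (fun I hI => ?_) (fun I hI => ?_) (fun I hI => ?_) (fun I hI => ?_)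
  · simp only [Finset.mem_filter, Finset.mem_univ, true_and] at hI ⊢
    obtain ⟨h1, h2, h3, h4⟩ := hI
    refine ⟨fun x hx => ⟨h1 (Finset.mem_of_mem_erase hx), ?_⟩, h2.mono (by simp), ?_⟩
    · have hx' := Finset.mem_erase.1 hx
      rintro (rfl | h)
      · exact hx'.1 rfl
      · exact h2 h4 hx'.2 hx'.1.symm h
    · rwa [Finset.insert_erase h4]
  · simp only [Finset.mem_filter, Finset.mem_univ, true_and] at hI ⊢
    obtain ⟨h1, h2, h3⟩ := hI
    refine ⟨?_, ?_, h3, Finset.mem_insert_self _ _⟩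
    · rw [Finset.coe_insert]
      exact Set.insert_subset hv fun x hx => (h1 hx).1
    · rw [Finset.coe_insert]
      exact Set.pairwise_insert.2 ⟨h2, fun x hx _ => ⟨fun h => (h1 hx).2 (Or.inr h),
        fun h => (h1 hx).2 (Or.inr h.symm)⟩⟩
  · exact Finset.insert_erase (Finset.mem_filter.1 hI).2.2.2.2
  · simp only [Finset.mem_filter, Finset.mem_univ, true_and] at hI
    exact Finset.erase_insert fun h => (hI.1 h).2 (Or.inl rfl)
  · have h4 := (Finset.mem_filter.1 hI).2.2.2.2
    rw [← pow_succ', Finset.card_erase_add_one h4]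

theorem indepWeight_mem_and_mem {u v : V} (hv : v ∈ A) (huv : u ≠ v) :
    indepWeight G lam A (fun I => u ∈ I ∧ v ∈ I) =
      lam * indepWeight G lam (A \ {x | x = v ∨ G.Adj v x}) fun I => u ∈ I := by
  classical
  rw [indepWeight_and_mem hv]
  simp [huv]

theorem indepWeight_mem {v : V} (hv : v ∈ A) :
    indepWeight G lam A (fun I => v ∈ I) =
      lam * indepWeight G lam (A \ {x | x = v ∨ G.Adj v x}) fun _ => True := by
  simpa using indepWeight_and_mem (G := G) (lam := lam) hv fun _ => True

theorem indepWeight_notMem (v : V) :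
    indepWeight G lam A (fun I => v ∉ I) = indepWeight G lam (A \ {v}) fun _ => True := by
  simpa using indepWeight_and_notMem (G := G) (lam := lam) (A := A) v fun _ => True

theorem indepWeight_true_pos (hlam : 0 < lam) : 0 < indepWeight G lam A fun _ => True := by
  classical
  refine Finset.sum_pos (fun _ _ => by positivity) ⟨∅, ?_⟩
  simp [SimpleGraph.IsIndepSet]

theorem indepWeight_mem_pos (hlam : 0 < lam) {v : V} (hv : v ∈ A) :
    0 < indepWeight G lam A fun I => v ∈ I := by
  rw [indepWeight_mem hv]
  exact mul_pos hlam (indepWeight_true_pos hlam)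

theorem indepWeight_notMem_pos (hlam : 0 < lam) (v : V) :
    0 < indepWeight G lam A fun I => v ∉ I := by
  rw [indepWeight_notMem]
  exact indepWeight_true_pos hlam

theorem marginal_pos (hlam : 0 < lam) {v : V} (hv : v ∈ A) : 0 < marginal G lam A v :=
  div_pos (indepWeight_mem_pos hlam hv) (indepWeight_true_pos hlam)

theorem marginal_of_notMem {v : V} (hv : v ∉ A) : marginal G lam A v = 0 := by
  classical
  have : indepWeight G lam A (fun I => v ∈ I) = 0 :=
    (indepWeight_congr (Q := fun _ => False)
      fun I hI => iff_false_intro fun h => hv (hI h)).trans (by simp [indepWeight])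
  rw [marginal, this, zero_div]

theorem indepWeight_sdiff_div (hlam : 0 < lam) (v : V) :
    indepWeight G lam (A \ {v}) (fun _ => True) / indepWeight G lam A (fun _ => True) =
      1 - marginal G lam A v := by
  have h := (indepWeight_true_pos (G := G) (A := A) hlam).ne'
  rw [marginal, ← indepWeight_notMem, eq_sub_iff_add_eq, ← add_div, add_comm,
    indepWeight_add_not, div_self h]

/-- The law of total probability for the occupation of `u`. -/
theorem marginal_sub_marginal (hlam : 0 < lam) {u v : V} (hv : v ∈ A) (huv : u ≠ v) :
    marginal G lam A u - marginal G lam (A \ {v}) u = marginal G lam A v *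
      (marginal G lam (A \ {x | x = v ∨ G.Adj v x}) u - marginal G lam (A \ {v}) u) := by
  have h1 := indepWeight_and_add_and_not (G := G) (lam := lam) (A := A) (fun I => u ∈ I)
    fun I => v ∈ I
  rw [indepWeight_mem_and_mem hv huv, indepWeight_and_notMem] at h1
  have h2 := indepWeight_add_not (G := G) (lam := lam) (A := A) fun I => v ∈ I
  rw [indepWeight_mem hv, indepWeight_notMem] at h2
  have hA := indepWeight_true_pos (G := G) (A := A) hlam
  have hB := indepWeight_true_pos (G := G) (A := A \ {v}) hlam
  have hC := indepWeight_true_pos (G := G) (A := A \ {x | x = v ∨ G.Adj v x}) hlam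
  simp only [marginal]
  rw [indepWeight_mem hv, ← h1]
  rw [← h2] at hA ⊢
  field_simp
  ring

theorem exp_occupationLogRatio (hlam : 0 < lam) (x : SAWState V) :
    Real.exp (occupationLogRatio G lam x) =
      indepWeight G lam x.1.1 (fun I => x.1.2 ∈ I) /
        indepWeight G lam x.1.1 fun I => x.1.2 ∉ I :=
  Real.exp_log (div_pos (indepWeight_mem_pos hlam x.2) (indepWeight_notMem_pos hlam _))

/-- As a quotient of partition functions before and after deleting a vertex, this telescopes when
neighbours are deleted successively. -/
theorem one_add_exp_occupationLogRatio (hlam : 0 < lam) (x : SAWState V) :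
    1 + Real.exp (occupationLogRatio G lam x) =
      indepWeight G lam x.1.1 (fun _ => True) /
        indepWeight G lam (x.1.1 \ {x.1.2}) fun _ => True := by
  rw [exp_occupationLogRatio hlam, ← indepWeight_notMem,
    ← indepWeight_add_not fun I => x.1.2 ∈ I, add_div,
    div_self (indepWeight_notMem_pos hlam _).ne', add_comm]

theorem sigmoid_occupationLogRatio (hlam : 0 < lam) (x : SAWState V) :
    Real.sigmoid (occupationLogRatio G lam x) = marginal G lam x.1.1 x.1.2 := by
  have h : Real.sigmoid (occupationLogRatio G lam x) =
      1 - 1 / (1 + Real.exp (occupationLogRatio G lam x)) := by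
    rw [← neg_neg (occupationLogRatio G lam x), Real.sigmoid_neg, neg_neg, Real.sigmoid_def,
      neg_neg, one_div]
  rw [h, one_add_exp_occupationLogRatio hlam, one_div_div, indepWeight_sdiff_div hlam,
    sub_sub_cancel]

/-! ### Deleting the neighbours one at a time -/

section Telescope

variable [LinearOrder V]

/-- The vertex sets of the child subproblems are the intermediate stages of deleting the neighbours
of `v` in increasing order. With `g` the log-partition function this gives Weitz's recursion; with
`g` a marginal it splits the influence of `v` among its children. -/
theorem sum_sawChild_telescope (G : SimpleGraph V) (A : Set V) (v : V) (g : Set V → ℝ) :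
    ∑ c : SAWChild G A v, (g ((A \ {x | x = v ∨ (G.Adj v x ∧ x < c.1)}) \ {c.1}) -
      g (A \ {x | x = v ∨ (G.Adj v x ∧ x < c.1)})) =
        g (A \ {x | x = v ∨ G.Adj v x}) - g (A \ {v}) := by
  classical
  set S : Finset V := Finset.univ.filter fun w => w ∈ A ∧ G.Adj v w with hS
  have key := sum_filter_le_sub_filter_lt S fun T => g (A \ {x | x = v ∨ x ∈ T})
  rw [Finset.sum_subtype S (p := fun w => w ∈ A ∧ G.Adj v w) (by simp [hS])] at key
  have hsets : A \ {x | x = v ∨ x ∈ S} = A \ {x | x = v ∨ G.Adj v x} := by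
    ext x
    simp only [hS, Set.mem_sdiff, Set.mem_ofPred_eq, Finset.mem_filter, Finset.mem_univ, true_and]
    tauto
  have hempty : A \ {x | x = v ∨ x ∈ (∅ : Finset V)} = A \ {v} := by
    ext x; simp
  rw [hsets, hempty] at key
  rw [← key]
  refine Finset.sum_congr rfl fun c _ => ?_
  congr 2
  · ext x
    simp only [hS, Set.mem_sdiff, Set.mem_ofPred_eq, Finset.mem_filter, Finset.mem_univ, true_and,
      le_iff_lt_or_eq, Set.mem_singleton_iff]
    have := c.2
    constructor
    · tauto
    · rintro ⟨h1, h2⟩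
      refine ⟨⟨h1, by tauto⟩, ?_⟩
      rintro rfl
      tauto
  · ext x
    simp only [hS, Set.mem_sdiff, Set.mem_ofPred_eq, Finset.mem_filter, Finset.mem_univ, true_and]
    tauto

/-- Weitz's recursion. -/
theorem occupationLogRatio_eq (hlam : 0 < lam) (x : SAWState V) :
    occupationLogRatio G lam x = Real.log lam -
      ∑ c, Real.log (1 + Real.exp (occupationLogRatio G lam (sawStep G x c))) := by
  have hZ : ∀ B : Set V, indepWeight G lam B (fun _ => True) ≠ 0 :=
    fun B => (indepWeight_true_pos hlam).ne'
  have key := sum_sawChild_telescope G x.1.1 x.1.2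
    fun B => Real.log (indepWeight G lam B fun _ => True)
  have hterm : ∀ c, Real.log (1 + Real.exp (occupationLogRatio G lam (sawStep G x c))) =
      -(Real.log (indepWeight G lam ((sawStep G x c).1.1 \ {(sawStep G x c).1.2}) fun _ => True) -
        Real.log (indepWeight G lam (sawStep G x c).1.1 fun _ => True)) := fun c => by
    rw [one_add_exp_occupationLogRatio hlam, Real.log_div (hZ _) (hZ _), neg_sub]
  rw [Finset.sum_congr rfl fun c _ => hterm c, Finset.sum_neg_distrib, sub_neg_eq_add]
  refine Eq.trans ?_ (congrArg _ key.symm)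
  rw [occupationLogRatio, indepWeight_mem x.2, indepWeight_notMem,
    Real.log_div (mul_ne_zero hlam.ne' (hZ _)) (hZ _), Real.log_mul hlam.ne' (hZ _)]
  ring

/-- The true log-ratios solve the recursion, so at shift 0 the weights in the level sums are true
marginals, at every unfolding depth. -/
theorem logRatio_occupationLogRatio (hlam : 0 < lam) (ℓ : ℕ) (x : SAWState V) :
    logRatio (sawStep G) lam (occupationLogRatio G lam) ℓ 0 x = occupationLogRatio G lam x := by
  induction ℓ generalizing x with
  | zero => rw [logRatio, zero_add]
  | succ ℓ ih =>
    rw [logRatio, occupationLogRatio_eq hlam]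
    simp only [ih]

/-- Induction along the tree: total probability extracts the marginal of the root, and the telescope
leaves the same quantity at each child. Each step deletes the root, so paths have fewer vertices to
use and `n` levels suffice. -/
theorem sum_abs_marginal_sub_le (hlam : 0 < lam) (n : ℕ) (x : SAWState V) (hn : x.1.1.ncard ≤ n) :
    ∑ u, |marginal G lam x.1.1 u - marginal G lam (x.1.1 \ {x.1.2}) u| ≤
      marginal G lam x.1.1 x.1.2 * ∑ ℓ ∈ Finset.range n,
        levelInfluence (sawStep G) lam (occupationLogRatio G lam) ℓ 0 x := by
  classical
  induction n generalizing x with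
  | zero =>
    have := (Set.ncard_eq_zero (Set.toFinite _)).1 (Nat.le_zero.1 hn)
    exact absurd x.2 (by simp [this])
  | succ n ih =>
    set p := marginal G lam x.1.1 x.1.2
    have hp : 0 ≤ p := (marginal_pos hlam x.2).le
    have hstep : ∀ c, (sawStep G x c).1.1.ncard ≤ n := fun c => by
      refine Nat.le_of_lt_succ (lt_of_lt_of_le (Set.ncard_lt_ncard ?_ (Set.toFinite _)) hn)
      exact ⟨Set.sdiff_subset, fun h => (h x.2).2 (Or.inl rfl)⟩
    have hterm : ∀ u, |marginal G lam x.1.1 u - marginal G lam (x.1.1 \ {x.1.2}) u| ≤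
        p * ((if u = x.1.2 then 1 else 0) + ∑ c, |marginal G lam (sawStep G x c).1.1 u -
          marginal G lam ((sawStep G x c).1.1 \ {(sawStep G x c).1.2}) u|) := fun u => by
      -- The root's effect on itself is the path of length 0.
      by_cases hu : u = x.1.2
      · have h0 : 0 ≤ ∑ c, |marginal G lam (sawStep G x c).1.1 u -
          marginal G lam ((sawStep G x c).1.1 \ {(sawStep G x c).1.2}) u| :=
          Finset.sum_nonneg fun _ _ => abs_nonneg _
        rw [if_pos hu, hu, marginal_of_notMem (A := x.1.1 \ {x.1.2}) (by simp), sub_zero,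
          abs_of_nonneg hp]
        rw [hu] at h0
        exact le_mul_of_one_le_right hp (by linarith)
      · rw [marginal_sub_marginal hlam x.2 hu, if_neg hu, zero_add, abs_mul, abs_of_nonneg hp,
          ← sum_sawChild_telescope G x.1.1 x.1.2 fun B => marginal G lam B u]
        refine mul_le_mul_of_nonneg_left ((Finset.abs_sum_le_sum_abs _ _).trans_eq ?_) hp
        exact Finset.sum_congr rfl fun c _ => abs_sub_comm _ _
    refine (Finset.sum_le_sum fun u _ => hterm u).trans ?_
    rw [← Finset.mul_sum, Finset.sum_add_distrib, Finset.sum_range_succ',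
      Finset.sum_comm (s := Finset.univ (α := V))]
    refine mul_le_mul_of_nonneg_left ?_ hp
    simp only [levelInfluence, Finset.sum_ite_eq', Finset.mem_univ, if_true]
    rw [add_comm, Finset.sum_comm (s := Finset.range n)]
    refine add_le_add_left (Finset.sum_le_sum fun c _ => (ih _ (hstep c)).trans_eq ?_) _
    rw [Finset.mul_sum]
    refine Finset.sum_congr rfl fun ℓ _ => ?_
    rw [logRatio_occupationLogRatio hlam, sigmoid_occupationLogRatio hlam]

end Telescope

/-! ### Influences in induced subgraphs -/

theorem hardCoreWeight_induce [Fintype A] {P : Finset A → Prop} {Q : Finset V → Prop}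
    (h : ∀ J : Finset A, P J ↔ Q (J.map (Function.Embedding.subtype _))) :
    hardCoreWeight (G.induce A) lam P = indepWeight G lam A Q := by
  classical
  rw [hardCoreWeight, indepWeight]
  have hmap : ∀ I : Finset V, (I : Set V) ⊆ A →
      (I.subtype (· ∈ A)).map (Function.Embedding.subtype _) = I := fun I hI =>
    Finset.subtype_map_of_mem fun x hx => hI hx
  have hindep : ∀ J : Finset A, (G.induce A).IsIndepSet (J : Set A) ↔
      G.IsIndepSet ((J.map (Function.Embedding.subtype _) : Finset V) : Set V) := fun J => by
    rw [Finset.coe_map, SimpleGraph.IsIndepSet, SimpleGraph.IsIndepSet, Set.InjOn.pairwise_image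
      (Function.Embedding.subtype _).injective.injOn]
    rfl
  refine Finset.sum_bij' (fun J _ => J.map (Function.Embedding.subtype _))
    (fun I _ => I.subtype (· ∈ A))
    (fun J hJ => ?_) (fun I hI => ?_) (fun J hJ => ?_) (fun I hI => ?_) (fun J hJ => ?_)
  · simp only [Finset.mem_filter, Finset.mem_univ, true_and] at hJ ⊢
    refine ⟨fun x hx => ?_, (hindep J).1 hJ.1, (h J).1 hJ.2⟩
    obtain ⟨y, _, rfl⟩ := Finset.mem_map.1 (Finset.mem_coe.1 hx)
    exact y.2
  · simp only [Finset.mem_filter, Finset.mem_univ, true_and] at hI ⊢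
    rw [hindep, h, hmap I hI.1]
    exact hI.2
  · ext x; simp
  · exact hmap I (Finset.mem_filter.1 hI).2.1
  · rw [Finset.card_map]

variable [Fintype A]

theorem influence_induce (hlam : 0 < lam) (a b : A) :
    influence (G.induce A) lam a b =
      indepWeight G lam A (fun I => ↑b ∈ I ∧ ↑a ∈ I) / indepWeight G lam A (fun I => ↑a ∈ I) -
      indepWeight G lam A (fun I => ↑b ∈ I ∧ ↑a ∉ I) / indepWeight G lam A fun I => ↑a ∉ I := by
  have hmem : ∀ (c : A) (J : Finset A), c ∈ J ↔
      (c : V) ∈ J.map (Function.Embedding.subtype _) := fun c J => by simp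
  have hZ := (indepWeight_true_pos (G := G) (A := A) hlam).ne'
  simp only [influence, hardCoreCondProb, hardCoreProb]
  rw [hardCoreWeight_induce (Q := fun I => ↑b ∈ I ∧ ↑a ∈ I) fun J =>
      and_congr (hmem b J) (hmem a J),
    hardCoreWeight_induce (Q := fun I => ↑b ∈ I ∧ ↑a ∉ I) fun J =>
      and_congr (hmem b J) (not_congr (hmem a J)),
    hardCoreWeight_induce (Q := fun I => ↑a ∈ I) fun J => hmem a J,
    hardCoreWeight_induce (Q := fun I => ↑a ∉ I) fun J => not_congr (hmem a J),
    hardCoreWeight_induce (Q := fun _ => True) fun J => Iff.rfl,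
    div_div_div_cancel_right₀ hZ, div_div_div_cancel_right₀ hZ]

theorem marginal_mul_influence (hlam : 0 < lam) {a b : A} (hab : a ≠ b) :
    marginal G lam A a * influence (G.induce A) lam a b =
      marginal G lam A b - marginal G lam (A \ {(a : V)}) b := by
  have hba : (b : V) ≠ a := fun h => hab (Subtype.ext h.symm)
  rw [marginal_sub_marginal hlam a.2 hba, influence_induce hlam, indepWeight_mem_and_mem a.2 hba,
    indepWeight_and_notMem, indepWeight_mem a.2, indepWeight_notMem,
    mul_div_mul_left _ _ hlam.ne']
  rfl

/-- Both sides are the squared partition function times the covariance of the occupations of `a` and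
`b`. -/
theorem weight_mul_influence_symm (hlam : 0 < lam) (a b : A) :
    indepWeight G lam A (fun I => ↑a ∈ I) * indepWeight G lam A (fun I => ↑a ∉ I) *
        influence (G.induce A) lam a b =
      indepWeight G lam A (fun I => ↑b ∈ I) * indepWeight G lam A (fun I => ↑b ∉ I) *
        influence (G.induce A) lam b a := by
  have key : ∀ a b : A,
      indepWeight G lam A (fun I => ↑a ∈ I) * indepWeight G lam A (fun I => ↑a ∉ I) *
        influence (G.induce A) lam a b =
      indepWeight G lam A (fun I => ↑b ∈ I ∧ ↑a ∈ I) * indepWeight G lam A (fun _ => True) -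
      indepWeight G lam A (fun I => ↑a ∈ I) * indepWeight G lam A (fun I => ↑b ∈ I) :=
    fun a b => by
      have h1 := (indepWeight_mem_pos (G := G) hlam a.2).ne'
      have h2 := (indepWeight_notMem_pos (G := G) (A := A) hlam a).ne'
      have h3 := indepWeight_and_add_and_not (G := G) (lam := lam) (A := A) (fun I => ↑b ∈ I)
        fun I => ↑a ∈ I
      have h4 := indepWeight_add_not (G := G) (lam := lam) (A := A) fun I => ↑a ∈ I
      rw [influence_induce hlam, ← h3, ← h4]
      field_simp
      ring
  rw [key, key]
  simp only [and_comm (a := (b : V) ∈ _)]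
  ring

theorem sum_abs_influence_le [LinearOrder V] (hlam : 0 < lam) {K : ℝ}
    (hK : ∀ n x, ∑ ℓ ∈ Finset.range n,
      levelInfluence (sawStep G) lam (occupationLogRatio G lam) ℓ 0 x ≤ K) (a : A) :
    ∑ b, |influenceMatrix (G.induce A) lam a b| ≤ K := by
  classical
  have hp := marginal_pos (G := G) hlam a.2
  have h1 := (sum_abs_marginal_sub_le (G := G) hlam A.ncard ⟨(A, a), a.2⟩ le_rfl).trans
    (mul_le_mul_of_nonneg_left (hK _ _) hp.le)
  refine le_of_mul_le_mul_left (le_trans ?_ h1) hp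
  rw [Finset.mul_sum]
  calc ∑ b : A, marginal G lam A a * |influenceMatrix (G.induce A) lam a b|
      ≤ ∑ b : A, |marginal G lam A b - marginal G lam (A \ {(a : V)}) b| :=
        Finset.sum_le_sum fun b _ => by
          rw [influenceMatrix, Matrix.of_apply]
          split_ifs with hab
          · simp
          · rw [← marginal_mul_influence hlam hab, abs_mul, abs_of_pos hp]
    _ = ∑ u ∈ Finset.univ.map (Function.Embedding.subtype (· ∈ A)),
          |marginal G lam A u - marginal G lam (A \ {(a : V)}) u| := by
        rw [Finset.sum_map]; rfl
    _ ≤ _ := Finset.sum_le_sum_of_subset_of_nonneg (Finset.subset_univ _)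
        fun _ _ _ => abs_nonneg _

end Marginals

/-! ### Eigenvalues of symmetrizable matrices -/

/-- `M` is self-adjoint for the inner product with weights `d`, so its eigenvalues are real; the
upper bound is Gershgorin's theorem. -/
theorem spectrum_im_eq_zero_and_re_le {n : Type*} [Fintype n] {_ : DecidableEq n} {M : Matrix n n ℝ}
    {d : n → ℝ} {K : ℝ} (hd : ∀ a, 0 < d a) (hM : ∀ a b, d a * M a b = d b * M b a)
    (hK : ∀ a, ∑ b, |M a b| ≤ K) {z : ℂ} (hz : z ∈ spectrum ℂ (M.map Complex.ofReal)) :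
    z.im = 0 ∧ z.re ≤ K := by
  rw [← Matrix.spectrum_toLin', ← Module.End.hasEigenvalue_iff_mem_spectrum] at hz
  constructor
  · obtain ⟨y, hy⟩ := hz.exists_hasEigenvector
    have hyz : ∀ a, ∑ b, (M a b : ℂ) * y b = z * y a := fun a => by
      simpa [Matrix.mulVec, dotProduct] using congrFun hy.apply_eq_smul a
    set N : ℝ := ∑ a, d a * Complex.normSq (y a) with hN
    have hN0 : 0 < N := by
      obtain ⟨a, ha⟩ := Function.ne_iff.1 hy.2
      exact Finset.sum_pos' (fun b _ => mul_nonneg (hd b).le (Complex.normSq_nonneg _))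
        ⟨a, Finset.mem_univ _, mul_pos (hd a) (Complex.normSq_pos.2 ha)⟩
    -- The weighted form of `y` with `M y`: it is `z` times the weighted norm, and real by symmetry.
    set Q : ℂ := ∑ a, ∑ b, (d a * M a b : ℝ) * (starRingEnd ℂ (y a) * y b) with hQ
    have hQz : Q = z * N := by
      rw [hQ, hN, Complex.ofReal_sum, Finset.mul_sum]
      refine Finset.sum_congr rfl fun a _ => ?_
      calc ∑ b, ((d a * M a b : ℝ) : ℂ) * (starRingEnd ℂ (y a) * y b)
          = d a * starRingEnd ℂ (y a) * ∑ b, (M a b : ℂ) * y b := by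
            rw [Finset.mul_sum]
            exact Finset.sum_congr rfl fun b _ => by push_cast; ring
        _ = z * (d a * Complex.normSq (y a) : ℝ) := by
            rw [hyz, Complex.ofReal_mul, Complex.normSq_eq_conj_mul_self]
            ring
    have hQconj : starRingEnd ℂ Q = Q := by
      rw [hQ, map_sum, Finset.sum_comm]
      simp only [map_sum, map_mul, Complex.conj_ofReal, Complex.conj_conj]
      rw [Finset.sum_comm]
      conv_rhs => rw [Finset.sum_comm]
      refine Finset.sum_congr rfl fun a _ => Finset.sum_congr rfl fun b _ => ?_
      rw [hM a b]
      ring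
    have him := Complex.conj_eq_iff_im.1 hQconj
    rw [hQz, Complex.im_mul_ofReal] at him
    exact (mul_eq_zero.1 him).resolve_right hN0.ne'
  · obtain ⟨a, ha⟩ := eigenvalue_mem_ball hz
    rw [mem_closedBall_iff_norm] at ha
    simp only [Matrix.map_apply, Complex.norm_real, Real.norm_eq_abs] at ha
    have h1 := (Complex.re_le_norm _).trans ha
    have h2 := Finset.add_sum_erase Finset.univ (fun b => |M a b|) (Finset.mem_univ a)
    have h3 := le_abs_self (M a a)
    simp only [Complex.sub_re, Complex.ofReal_re] at h1
    linarith [hK a]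

theorem corollary1p6 {ι : Type*} {V : ι → Type*} [∀ i, Fintype (V i)]
    (G : ∀ i, SimpleGraph (V i)) [∀ i, DecidableRel (G i).Adj]
    (Δ : ℕ) (hΔ : ∀ i, (G i).maxDegree ≤ Δ)
    (lam : ℝ) (hlam : 0 < lam) (hVSSM : VSSM G lam) :
    SpectrallyIndependent G lam := by
  classical
  obtain ⟨α, c, hα, hα1, hc, h⟩ := hVSSM
  obtain ⟨K, hK⟩ := exists_sum_levelInfluence_le hlam Δ hα hα1 hc
  -- The maximum only ensures positivity; `K` comes without a sign.
  refine ⟨max K 1, lt_max_of_lt_right one_pos, fun i A z hz => ?_⟩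
  obtain ⟨_, hi⟩ := h i
  have hcard : ∀ x : SAWState (V i), Fintype.card (SAWChild (G i) x.1.1 x.1.2) ≤ Δ := fun x => by
    refine le_trans ?_ (((G i).degree_le_maxDegree x.1.2).trans (hΔ i))
    rw [← SimpleGraph.card_neighborSet_eq_degree]
    exact Fintype.card_le_of_injective
      (fun w => (⟨w.1, w.2.2⟩ : (G i).neighborSet x.1.2)) fun w w' hw =>
        Subtype.ext (congrArg (fun y => y.1) hw)
  have hbound := hK (SAWState (V i)) (fun x => SAWChild (G i) x.1.1 x.1.2) (sawStep (G i))
    (occupationLogRatio (G i) lam) hcard (fun ℓ x => by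
      -- Of VSSM only the two constant boundary conditions enter; all others met in the argument lie
      -- between them by monotonicity.
      have := hi x.1.1 x.1.2 x.2 (ℓ + 1) (by omega)
        (levelBoundary (ℓ + 1) true (G i) x.1.1 x.1.2)
        (levelBoundary (ℓ + 1) false (G i) x.1.1 x.1.2) rfl rfl
      rw [condRatio_levelBoundary ℓ true hlam, condRatio_levelBoundary ℓ false hlam] at this
      simpa using this)
  have hspec := spectrum_im_eq_zero_and_re_le
    (d := fun a : A => indepWeight (G i) lam A (fun I => ↑a ∈ I) *
      indepWeight (G i) lam A (fun I => ↑a ∉ I))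
    (fun a => mul_pos (indepWeight_mem_pos hlam a.2) (indepWeight_notMem_pos hlam _))
    (fun a b => by
      simp only [influenceMatrix, Matrix.of_apply]
      by_cases hab : a = b
      · simp [hab]
      · rw [if_neg hab, if_neg (Ne.symm hab)]
        exact weight_mul_influence_symm hlam a b)
    (fun a => sum_abs_influence_le hlam (fun n x => hbound n 0 x) a) hz
  exact ⟨hspec.1, hspec.2.trans (le_max_left _ _)⟩
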